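/- **Theorem.** Let $k$ be a $C1$ field, that is, a field such that every homogeneous polynomial of degree $d$ with $1\le d\le m$ in $m+1$ variables over $k$ has a nontrivial zero in $k^{m+1}$. Let $n\ge 3$, let $f\in k[x_0,\dots,x_n]$ be a nonzero homogeneous polynomial of degree $3$, and let $X=V(f)\subset\mathbb{P}^n_k$ be the cubic hypersurface defined by $f$ (with its natural or its reduced scheme structure, or any other closed subscheme structure on the same closed set). Suppose that $X$ has a $k$-rational singular point, i.e. that there is a point $x\in\mathbb{P}^n(k)$ with $f(x)=0$ and $\frac{\partial f}{\partial x_i}(x)=0$ for all $0\le i\le n$. Then $$[X]\equiv 1 \mod \mathbb{L}\qquad\text{in } K_0(Var_k),$$ i.e. $[X]-1$ lies in the ideal generated by $\mathbb{L}$. Here $K_0(Var_k)$ is the abelian group generated by the isomorphism classes $[X]$ of varieties over $k$ (separated schemes of finite type over $k$; requiring them to be reduced gives the same ring) with the relations $[X]=[X\setminus Y]+[Y]$ for every closed subvariety $Y\subset X$, made into a ring by $[X]\cdot[Z]=[X\times_k Z]$, with unit $1=[\operatorname{Spec} k]$, and $\mathbb{L}=[\mathbb{A}^1_k]$. -/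

import Mathlib

open CategoryTheory AlgebraicGeometry MonoidalCategory

universe u

noncomputable section

namespace GrothendieckRing

/-! ### The category of varieties and its Grothendieck ring -/

/-- The property, for a scheme `X` over a field `k`, of being separated and of finite type
(locally of finite type and quasi-compact) over `k`. -/
def isVariety (k : Type u) [Field k] : ObjectProperty (Over (Spec (CommRingCat.of k))) :=
  fun X => IsSeparated X.hom ∧ LocallyOfFiniteType X.hom ∧ QuasiCompact X.hom

/-- `Spec k` is a variety and the fibre product over `k` of two varieties is a variety. -/
instance isVariety_isMonoidal (k : Type u) [Field k] : (isVariety k).IsMonoidal where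
  prop_unit := by
    change IsSeparated (𝟙 (Spec (CommRingCat.of k))) ∧
      LocallyOfFiniteType (𝟙 (Spec (CommRingCat.of k))) ∧
      QuasiCompact (𝟙 (Spec (CommRingCat.of k)))
    exact ⟨inferInstance, inferInstance, inferInstance⟩
  prop_tensor X Y hX hY := by
    obtain ⟨h₁, h₂, h₃⟩ := hX
    obtain ⟨h₄, h₅, h₆⟩ := hY
    refine ⟨?_, ?_, ?_⟩ <;> (rw [Over.tensorObj_hom]; infer_instance)

/-- The category of separated schemes of finite type over `k`, with the fibre product over `k` as
tensor product and `Spec k` as unit. Reducedness is not required: it makes no difference to the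
Grothendieck ring, since the scissor relation for the closed subscheme `X_red` of `X`, whose open
complement is empty, gives `[X] = [X_red]`; and without it the product of two varieties is the
fibre product itself, over every field. -/
abbrev Variety (k : Type u) [Field k] : Type (u + 1) := (isVariety k).FullSubcategory

/-- The free abelian group on the isomorphism classes of varieties over `k`. Its multiplication is
the bilinear extension of the product `X ×ₖ Y` of isomorphism classes. -/
abbrev FreeClasses (k : Type u) [Field k] : Type (u + 1) :=
  FreeAbelianGroup (Skeleton (Variety k))

/-- The isomorphism class of `X`, as a generator of the free abelian group. -/
def freeClass {k : Type u} [Field k] (X : Variety k) : FreeClasses k :=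
  FreeAbelianGroup.of (toSkeleton X)

/-- The scissor relators `[X] - [X ∖ Y] - [Y]`: here `Y` is a closed subscheme of `X` and `U` is
the open subscheme of `X` whose underlying set is the complement of `Y`. -/
def scissorRelators (k : Type u) [Field k] : Set (FreeClasses k) :=
  {r | ∃ (X U Y : Variety k) (j : U ⟶ X) (i : Y ⟶ X),
    IsOpenImmersion j.hom.left ∧ IsClosedImmersion i.hom.left ∧
    Set.range j.hom.left = (Set.range i.hom.left)ᶜ ∧
    r = freeClass X - freeClass U - freeClass Y}

theorem freeClass_mul {k : Type u} [Field k] (X Y : Variety k) :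
    freeClass X * freeClass Y = freeClass (X ⊗ Y) := by
  rw [freeClass, freeClass, freeClass, ← FreeAbelianGroup.of_mul, Skeleton.toSkeleton_tensorObj]

/-- The product of a variety with a scissor relator is a scissor relator. -/
theorem freeClass_mul_mem {k : Type u} [Field k] (Z : Variety k) {r : FreeClasses k}
    (hr : r ∈ scissorRelators k) : freeClass Z * r ∈ scissorRelators k := by
  obtain ⟨X, U, Y, j, i, hj, hi, hc, rfl⟩ := hr
  have key (T : Variety k) (f : T ⟶ X) :
      IsPullback (Z.obj ◁ f.hom).left (Limits.pullback.snd Z.obj.hom T.obj.hom)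
        (Limits.pullback.snd Z.obj.hom X.obj.hom) f.hom.left := by
    refine IsPullback.of_right (h₁₂ := Limits.pullback.fst Z.obj.hom X.obj.hom)
      (v₁₃ := Z.obj.hom) (h₂₂ := X.obj.hom) ?_ (Over.whiskerLeft_left_snd f.hom)
      (IsPullback.of_hasPullback Z.obj.hom X.obj.hom).flip.flip
    rw [Over.whiskerLeft_left_fst, Over.w]
    exact IsPullback.of_hasPullback Z.obj.hom T.obj.hom
  have hrange (T : Variety k) (f : T ⟶ X) :
      Set.range (Z.obj ◁ f.hom).left =
        Limits.pullback.snd Z.obj.hom X.obj.hom ⁻¹' Set.range f.hom.left := by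
    rw [Over.whiskerLeft_left]
    refine (Scheme.Pullback.range_map ..).trans ?_
    rw [Set.range_eq_univ.mpr (Scheme.Hom.surjective (𝟙 Z.obj.left)), Set.preimage_univ,
      Set.univ_inter]
  refine ⟨Z ⊗ X, Z ⊗ U, Z ⊗ Y, Z ◁ j, Z ◁ i, ?_, ?_, ?_, ?_⟩
  · exact MorphismProperty.of_isPullback (P := @IsOpenImmersion) (key U j).flip hj
  · exact MorphismProperty.of_isPullback (P := @IsClosedImmersion) (key Y i).flip hi
  · refine (hrange U j).trans ?_
    rw [hc, Set.preimage_compl]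
    exact congrArg compl (hrange Y i).symm
  · simp only [mul_sub, freeClass_mul]

/-- The ideal of scissor relations: the subgroup generated by the scissor relators. -/
def scissorIdeal (k : Type u) [Field k] : Ideal (FreeClasses k) :=
  { AddSubgroup.closure (scissorRelators k) with
    smul_mem' := fun c r hr => by
      change r ∈ AddSubgroup.closure (scissorRelators k) at hr
      change c * r ∈ AddSubgroup.closure (scissorRelators k)
      induction c using FreeAbelianGroup.induction_on with
      | zero => rw [zero_mul]; exact zero_mem _
      | of x =>
        obtain ⟨Z, rfl⟩ := Quotient.exists_rep x
        induction hr using AddSubgroup.closure_induction with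
        | mem r hr => exact AddSubgroup.subset_closure (freeClass_mul_mem Z hr)
        | zero => rw [mul_zero]; exact zero_mem _
        | add r s _ _ h₁ h₂ => rw [mul_add]; exact add_mem h₁ h₂
        | neg r _ h => rw [mul_neg]; exact neg_mem h
      | neg x h => rw [neg_mul]; exact neg_mem h
      | add x y h₁ h₂ => rw [add_mul]; exact add_mem h₁ h₂ }

/-- The Grothendieck ring of varieties `K₀(Var_k)`. -/
abbrev K0Var (k : Type u) [Field k] : Type (u + 1) := FreeClasses k ⧸ scissorIdeal k

/-- The class `[X]` of a variety `X` in `K₀(Var_k)`. -/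
def cls {k : Type u} [Field k] (X : Variety k) : K0Var k :=
  Ideal.Quotient.mk (scissorIdeal k) (freeClass X)

/-- The affine line over `k`. -/
def affineLine (k : Type u) [Field k] : Variety k where
  obj := Over.mk (𝔸(PUnit.{u + 1}; Spec (CommRingCat.of k)) ↘ Spec (CommRingCat.of k))
  property := ⟨by dsimp; infer_instance, by dsimp; infer_instance, by dsimp; infer_instance⟩

/-- The class `𝕃` of the affine line in `K₀(Var_k)`. -/
def lefschetz (k : Type u) [Field k] : K0Var k := cls (affineLine k)

/-! ### Projective space and hypersurfaces -/

attribute [local instance] MvPolynomial.gradedAlgebra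

/-- The structure morphism `Proj k[x₀, …, xₙ] ⟶ Spec k`. -/
def projToSpec (k : Type u) [Field k] (n : ℕ) :
    Proj (MvPolynomial.homogeneousSubmodule (Fin (n + 1)) k) ⟶ Spec (CommRingCat.of k) :=
  Proj.toSpecZero (MvPolynomial.homogeneousSubmodule (Fin (n + 1)) k) ≫
    Spec.map (CommRingCat.ofHom
      (algebraMap k (MvPolynomial.homogeneousSubmodule (Fin (n + 1)) k 0)))

theorem isVariety_projToSpec (k : Type u) [Field k] (n : ℕ) :
    isVariety k (Over.mk (projToSpec k n)) := by
  have h₀ : Function.Surjective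
      (algebraMap k (MvPolynomial.homogeneousSubmodule (Fin (n + 1)) k 0)) := by
    rintro ⟨p, hp⟩
    rw [MvPolynomial.homogeneousSubmodule_zero, Submodule.mem_one] at hp
    obtain ⟨c, rfl⟩ := hp
    exact ⟨c, rfl⟩
  have h₁ : LocallyOfFiniteType (Spec.map (CommRingCat.ofHom
      (algebraMap k (MvPolynomial.homogeneousSubmodule (Fin (n + 1)) k 0)))) := by
    rw [HasRingHomProperty.Spec_iff (P := @LocallyOfFiniteType)]
    exact RingHom.FiniteType.of_surjective _ h₀
  have h₂ : IsScalarTower k (MvPolynomial.homogeneousSubmodule (Fin (n + 1)) k 0)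
    (MvPolynomial (Fin (n + 1)) k) :=
    ⟨fun a b c => by
      change (algebraMap _ (MvPolynomial (Fin (n + 1)) k) (a • b)) * c =
        a • (algebraMap _ (MvPolynomial (Fin (n + 1)) k) b * c)
      rw [← smul_mul_assoc]
      rfl⟩
  have h₃ : Algebra.FiniteType (MvPolynomial.homogeneousSubmodule (Fin (n + 1)) k 0)
      (MvPolynomial (Fin (n + 1)) k) := Algebra.FiniteType.of_restrictScalars_finiteType k _ _
  refine ⟨?_, ?_, ?_⟩ <;> (dsimp [projToSpec]; infer_instance)

/-- The projective space `ℙⁿ` over `k`. -/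
def projectiveSpace (k : Type u) [Field k] (n : ℕ) : Variety k where
  obj := Over.mk (projToSpec k n)
  property := isVariety_projToSpec k n

/-- The closed subset `V(f)` of `ℙⁿ`, as a set of scheme-theoretic points: the relevant homogeneous
primes that contain `f`. -/
def zeroSet {k : Type u} [Field k] {n : ℕ} (f : MvPolynomial (Fin (n + 1)) k) :
    Set (projectiveSpace k n).obj.left :=
  ProjectiveSpectrum.zeroLocus (MvPolynomial.homogeneousSubmodule (Fin (n + 1)) k) {f}

/-- The morphism `i` embeds `X` as a closed subscheme of `ℙⁿ` with underlying set `V(f)`. This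
holds for `V(f)` with its natural scheme structure and for `V(f)` with its reduced structure. -/
structure IsHypersurface {k : Type u} [Field k] {n : ℕ} (f : MvPolynomial (Fin (n + 1)) k)
    {X : Variety k} (i : X ⟶ projectiveSpace k n) : Prop where
  isClosedImmersion : IsClosedImmersion i.hom.left
  range_eq : Set.range i.hom.left = zeroSet f

/-- The `k`-rational points of `ℙⁿ` that are singular points of the hypersurface `V(f)`: the common
zeros of `f` and all its partial derivatives. As these are homogeneous when `f` is, the condition
does not depend on the representative. -/
def singularPoints {k : Type u} [Field k] {n : ℕ} (f : MvPolynomial (Fin (n + 1)) k) :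
    Set (Projectivization k (Fin (n + 1) → k)) :=
  {x | MvPolynomial.eval x.rep f = 0 ∧ ∀ i, MvPolynomial.eval x.rep (MvPolynomial.pderiv i f) = 0}

/-- A field is `C1` if every homogeneous polynomial of degree `d` with `1 ≤ d ≤ n` in `n + 1`
variables has a nontrivial zero. -/
def IsC1Field (k : Type u) [Field k] : Prop :=
  ∀ (n d : ℕ), 1 ≤ d → d ≤ n → ∀ F : MvPolynomial (Fin (n + 1)) k, F.IsHomogeneous d →
    ∃ a : Fin (n + 1) → k, a ≠ 0 ∧ MvPolynomial.eval a F = 0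

end GrothendieckRing

end

/-!
# Cubic hypersurfaces with a rational singular point over a `C1` field

The proof passes from a projective hypersurface `X = V(f)` to its affine cone `C = V(f)` in affine
space. The punctured cone is a `𝔾ₘ`-torsor over `X`, trivial over each stratum
`x₀ = ⋯ = xⱼ₋₁ = 0 ≠ xⱼ`, so that `[C] = 1 + (𝕃 - 1)[X]` and `[X] ≡ 1 - [C]` modulo `𝕃`
(`IsClassOf.mk_eq_one_sub`). It remains to see that `[C] ≡ 0`. On the cone, a linear change of
coordinates is an automorphism of a polynomial ring, and only affine varieties occur.

Move the singular point to `(1, 0, …, 0)`. Then `f = x₀ q + c` for forms `q`, `c` of degrees `2`, `3`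
in the other variables. Where `q ≠ 0`, the equation determines `x₀`; where `q = 0`, it says that
`c = 0` and leaves `x₀` free. Hence `[V(x₀ q + c)] ≡ [D(q)] = [𝔸ⁿ] - [V(q)] ≡ -[V(q)]` modulo `𝕃`
(`specClsModL_linear`). The quadratic form `q` in `n ≥ 3` variables has a nontrivial zero because
the field is `C1`; moved to `(1, 0, …, 0)`, this zero makes `q` linear in its first variable, say
`q = y₀ l + r`, and `[V(q)] ≡ -[V(l)]`. Finally `l` is a linear form in at least two variables, so
it has a nontrivial zero, `V(l)` is the product of a line and a smaller cone, and `[V(l)] ≡ 0`.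

Cutting and pasting is done with `IsClassOf X S c`, which says that the locally closed subset `S` of
the variety `X` has the class `c`. This depends on the set `S` only (`IsClassOf.unique`), not on a
scheme structure, because a surjective closed immersion does not change the class.
-/

noncomputable section

namespace GrothendieckRing

attribute [local instance] MvPolynomial.gradedAlgebra

variable {k : Type u} [Field k]

/-! ### Classes of locally closed subsets -/

/-- The morphism of varieties given by a morphism of schemes over `k`. -/
def Variety.homMk {X Y : Variety k} (f : X.obj.left ⟶ Y.obj.left)
    (hf : f ≫ Y.obj.hom = X.obj.hom) : X ⟶ Y :=
  ObjectProperty.homMk (Over.homMk f hf)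

/-- A morphism of varieties is a morphism over `k`. -/
theorem Variety.w {X Y : Variety k} (f : X ⟶ Y) : f.hom.left ≫ Y.obj.hom = X.obj.hom :=
  Over.w f.hom

theorem Variety.comp_left {X Y Z : Variety k} (f : X ⟶ Y) (g : Y ⟶ Z) :
    (f ≫ g).hom.left = f.hom.left ≫ g.hom.left := rfl

/-- The scissor relation in `K₀(Var_k)`. -/
theorem cls_eq_add {X U Y : Variety k} (j : U ⟶ X) (i : Y ⟶ X)
    (hj : IsOpenImmersion j.hom.left) (hi : IsClosedImmersion i.hom.left)
    (h : Set.range j.hom.left = (Set.range i.hom.left)ᶜ) : cls X = cls U + cls Y := by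
  have hr : freeClass X - freeClass U - freeClass Y ∈ scissorIdeal k :=
    AddSubgroup.subset_closure ⟨X, U, Y, j, i, hj, hi, h, rfl⟩
  have := Ideal.Quotient.eq_zero_iff_mem.mpr hr
  simp only [map_sub] at this
  rw [sub_sub, sub_eq_zero] at this
  exact this

instance (X : Variety k) : IsSeparated X.obj.hom := X.property.1
instance (X : Variety k) : LocallyOfFiniteType X.obj.hom := X.property.2.1
instance (X : Variety k) : QuasiCompact X.obj.hom := X.property.2.2

instance (X : Variety k) : IsLocallyNoetherian X.obj.left :=
  LocallyOfFiniteType.isLocallyNoetherian X.obj.hom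

theorem Variety.isVariety_of_comp {X : Variety k} {Y : Scheme.{u}} (f : Y ⟶ X.obj.left)
    [IsSeparated f] [LocallyOfFiniteType f] [QuasiCompact f] :
    isVariety k (Over.mk (f ≫ X.obj.hom)) :=
  ⟨by dsimp; infer_instance, by dsimp; infer_instance, by dsimp; infer_instance⟩

/-- A scheme that is separated and of finite type over a variety, as a variety. -/
def Variety.ofHom {X : Variety k} {Y : Scheme.{u}} (f : Y ⟶ X.obj.left)
    [IsSeparated f] [LocallyOfFiniteType f] [QuasiCompact f] : Variety k :=
  ⟨Over.mk (f ≫ X.obj.hom), Variety.isVariety_of_comp f⟩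

/-- The structure morphism of `Variety.ofHom f`. -/
def Variety.ofHomMap {X : Variety k} {Y : Scheme.{u}} (f : Y ⟶ X.obj.left)
    [IsSeparated f] [LocallyOfFiniteType f] [QuasiCompact f] : Variety.ofHom f ⟶ X :=
  Variety.homMk f rfl

instance {X Y : Variety k} (f : X ⟶ Y) : IsSeparated f.hom.left := by
  have : IsSeparated (f.hom.left ≫ Y.obj.hom) := by rw [Variety.w]; infer_instance
  exact IsSeparated.of_comp _ Y.obj.hom

instance {X Y : Variety k} (f : X ⟶ Y) : LocallyOfFiniteType f.hom.left := by
  have : LocallyOfFiniteType (f.hom.left ≫ Y.obj.hom) := by rw [Variety.w]; infer_instance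
  exact locallyOfFiniteType_of_comp _ Y.obj.hom

instance {X Y : Variety k} (f : X ⟶ Y) : QuasiCompact f.hom.left := by
  have : QuasiCompact (f.hom.left ≫ Y.obj.hom) := by rw [Variety.w]; infer_instance
  exact QuasiCompact.of_comp _ Y.obj.hom

/-- The empty variety `X` is the disjoint union of `X` and `X`, so `[X] = [X] + [X]`. -/
theorem cls_eq_zero_of_isEmpty (X : Variety k) [IsEmpty X.obj.left] : cls X = 0 := by
  have := cls_eq_add (𝟙 X) (𝟙 X) (by change IsOpenImmersion (𝟙 _); infer_instance)
    (by change IsClosedImmersion (𝟙 _); infer_instance)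
    (by ext x; exact isEmptyElim x)
  simpa using this

/-- The empty variety is an open subvariety of every variety. -/
theorem exists_isEmpty_hom (X : Variety k) :
    ∃ (E : Variety k) (j : E ⟶ X), IsEmpty E.obj.left ∧ IsOpenImmersion j.hom.left := by
  refine ⟨Variety.ofHom (X := X) (⊥ : X.obj.left.Opens).ι, Variety.ofHomMap _, ?_, ?_⟩
  · exact ⟨fun x => x.2⟩
  · change IsOpenImmersion (⊥ : X.obj.left.Opens).ι; infer_instance

/-- A surjective closed immersion does not change the class: its open complement is empty. -/
theorem cls_eq_of_surjective {X Y : Variety k} (f : Y ⟶ X) (hf : IsPreimmersion f.hom.left)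
    (hs : Function.Surjective f.hom.left) : cls X = cls Y := by
  obtain ⟨E, j, hE, hj⟩ := exists_isEmpty_hom X
  have hi : IsClosedImmersion f.hom.left := .of_isPreimmersion _ (by
    rw [hs.range_eq]; exact isClosed_univ)
  rw [cls_eq_add j f hj hi (by rw [hs.range_eq, Set.range_eq_empty, Set.compl_univ]),
    cls_eq_zero_of_isEmpty E, zero_add]

/-- The class `c` is the class of the locally closed subset `S` of `X`: there is a variety `Y` of
class `c` with an immersion into `X` that has image `S`. `IsPreimmersion` does not mention that the
image is locally closed; all that is used is that a preimmersion with closed image is a closed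
immersion. -/
def IsClassOf (X : Variety k) (S : Set X.obj.left) (c : K0Var k) : Prop :=
  ∃ (Y : Variety k) (g : Y ⟶ X), IsPreimmersion g.hom.left ∧ Set.range g.hom.left = S ∧ cls Y = c

/-- A locally closed subset of `X` that lies in the image of an immersion `f` pulls back along `f`
without a change of class. -/
theorem IsClassOf.of_subset_range {X Z : Variety k} (f : Z ⟶ X) (hf : IsPreimmersion f.hom.left)
    {S : Set X.obj.left} {c : K0Var k} (hS : S ⊆ Set.range f.hom.left) (h : IsClassOf X S c) :
    IsClassOf Z (f.hom.left ⁻¹' S) c := by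
  obtain ⟨Y, g, hg, rfl, rfl⟩ := h
  let P : Variety k := Variety.ofHom (X := Z) (Limits.pullback.fst f.hom.left g.hom.left)
  let p : P ⟶ Z := Variety.ofHomMap _
  let q : P ⟶ Y := Variety.homMk (Limits.pullback.snd f.hom.left g.hom.left) (by
    change _ = Limits.pullback.fst f.hom.left g.hom.left ≫ Z.obj.hom
    rw [← Variety.w g, ← Variety.w f, Limits.pullback.condition_assoc]
    rfl)
  have hq : IsPreimmersion q.hom.left := by
    change IsPreimmersion (Limits.pullback.snd f.hom.left g.hom.left); infer_instance
  refine ⟨P, p, ?_, ?_, ?_⟩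
  · change IsPreimmersion (Limits.pullback.fst f.hom.left g.hom.left); infer_instance
  · exact Scheme.Pullback.range_fst ..
  · refine (cls_eq_of_surjective q hq ?_).symm
    rw [← Set.range_eq_univ]
    refine (Scheme.Pullback.range_snd ..).trans ?_
    rw [Set.eq_univ_iff_forall]
    exact fun y => hS ⟨y, rfl⟩

theorem isClassOf_range {X Y : Variety k} (g : Y ⟶ X) (hg : IsPreimmersion g.hom.left) :
    IsClassOf X (Set.range g.hom.left) (cls Y) := ⟨Y, g, hg, rfl, rfl⟩

theorem isClassOf_univ (X : Variety k) : IsClassOf X Set.univ (cls X) :=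
  ⟨X, 𝟙 X, by change IsPreimmersion (𝟙 _); infer_instance,
    (Scheme.Hom.surjective (𝟙 X.obj.left)).range_eq, rfl⟩

/-- The class of a locally closed subset depends on the subset only. -/
theorem IsClassOf.unique {X : Variety k} {S : Set X.obj.left} {c c' : K0Var k}
    (h : IsClassOf X S c) (h' : IsClassOf X S c') : c = c' := by
  obtain ⟨Y, g, hg, rfl, rfl⟩ := h
  obtain ⟨Z, p, hp, hZ, rfl⟩ := h'.of_subset_range g hg le_rfl
  refine cls_eq_of_surjective p hp ?_
  rw [← Set.range_eq_univ, hZ]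
  exact Set.eq_univ_of_forall fun y => ⟨y, rfl⟩

theorem IsClassOf.of_range {X Z : Variety k} (f : Z ⟶ X) (hf : IsPreimmersion f.hom.left)
    {T : Set Z.obj.left} {c : K0Var k} (h : IsClassOf Z T c) :
    IsClassOf X (f.hom.left '' T) c := by
  obtain ⟨Y, g, hg, rfl, rfl⟩ := h
  refine ⟨Y, g ≫ f, ?_, ?_, rfl⟩
  · rw [Variety.comp_left]; infer_instance
  · rw [← Set.range_comp]
    rfl

theorem exists_isClassOf_of_isClosed (X : Variety k) {T : Set X.obj.left} (hT : IsClosed T) :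
    ∃ c, IsClassOf X T c := by
  let I := Scheme.IdealSheafData.vanishingIdeal (X := X.obj.left) ⟨T, hT⟩
  refine ⟨_, Variety.ofHom (X := X) I.subschemeι, Variety.ofHomMap _, ?_, ?_, rfl⟩
  · change IsPreimmersion I.subschemeι; infer_instance
  · refine I.range_subschemeι.trans ?_
    simp [I]

theorem IsClassOf.exists_inter_isClosed {X : Variety k} {S : Set X.obj.left} {c : K0Var k}
    (h : IsClassOf X S c) {T : Set X.obj.left} (hT : IsClosed T) : ∃ d, IsClassOf X (S ∩ T) d := by
  obtain ⟨Y, g, hg, rfl, rfl⟩ := h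
  obtain ⟨d, hd⟩ := exists_isClassOf_of_isClosed Y (hT.preimage g.hom.left.continuous)
  refine ⟨d, ?_⟩
  rw [← Set.image_preimage_eq_range_inter]
  exact hd.of_range g hg

/-- The scissor relation for locally closed subsets. -/
theorem IsClassOf.eq_add {X : Variety k} {S T : Set X.obj.left} {c a b : K0Var k}
    (hT : IsClosed T) (hc : IsClassOf X S c) (ha : IsClassOf X (S \ T) a)
    (hb : IsClassOf X (S ∩ T) b) : c = a + b := by
  obtain ⟨Y, g, hg, rfl, rfl⟩ := hc
  have ha' := ha.of_subset_range g hg Set.sdiff_subset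
  obtain ⟨Z, i, hi, hZ, rfl⟩ := hb.of_subset_range g hg Set.inter_subset_left
  have hg' : g.hom.left ⁻¹' Set.range g.hom.left = Set.univ :=
    Set.eq_univ_of_forall fun y => ⟨y, rfl⟩
  rw [Set.preimage_sdiff, hg', ← Set.compl_eq_univ_sdiff] at ha'
  rw [Set.preimage_inter, hg', Set.univ_inter] at hZ
  have hT' : IsClosed (g.hom.left ⁻¹' T) := hT.preimage g.hom.left.continuous
  let U : Y.obj.left.Opens := ⟨(g.hom.left ⁻¹' T)ᶜ, hT'.isOpen_compl⟩
  let V : Variety k := Variety.ofHom (X := Y) U.ι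
  let j : V ⟶ Y := Variety.ofHomMap _
  have hj : IsOpenImmersion j.hom.left := by change IsOpenImmersion U.ι; infer_instance
  have hjr : Set.range j.hom.left = (g.hom.left ⁻¹' T)ᶜ := U.range_ι
  rw [← hjr] at ha'
  rw [cls_eq_add j i hj (.of_isPreimmersion _ (hZ ▸ hT')) (by rw [hjr, hZ]),
    ha'.unique (isClassOf_range j inferInstance)]

theorem isClassOf_empty (X : Variety k) : IsClassOf X ∅ 0 := by
  obtain ⟨E, j, hE, hj⟩ := exists_isEmpty_hom X
  exact ⟨E, j, inferInstance, Set.range_eq_empty _, cls_eq_zero_of_isEmpty E⟩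

/-- A locally closed subset is the sum of the strata cut out by finitely many closed subsets
`T 0, …, T (m - 1)` and of what lies in all of them. -/
theorem IsClassOf.eq_sum_strata {X : Variety k} {S : Set X.obj.left} {c : K0Var k}
    (hc : IsClassOf X S c) {m : ℕ} {T : Fin m → Set X.obj.left} (hT : ∀ j, IsClosed (T j))
    {a : Fin m → K0Var k}
    (ha : ∀ j, IsClassOf X {x | (x ∈ S ∧ ∀ i < j, x ∈ T i) ∧ x ∉ T j} (a j)) {b : K0Var k}
    (hb : IsClassOf X {x | x ∈ S ∧ ∀ i, x ∈ T i} b) : c = ∑ j, a j + b := by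
  induction m generalizing b with
  | zero =>
    rw [Fin.sum_univ_zero, zero_add]
    refine hc.unique ?_
    convert hb using 1
    ext x
    exact ⟨fun h => ⟨h, fun i => i.elim0⟩, And.left⟩
  | succ m ih =>
    obtain ⟨d, hd⟩ := hc.exists_inter_isClosed (isClosed_iInter fun i : Fin m => hT i.castSucc)
    have hS : S ∩ ⋂ i : Fin m, T i.castSucc = {x | x ∈ S ∧ ∀ i : Fin m, x ∈ T i.castSucc} := by
      ext x
      exact and_congr_right fun _ => Set.mem_iInter
    rw [hS] at hd
    rw [ih (fun j => hT j.castSucc) (a := fun j => a j.castSucc) (fun j => ?_) hd,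
      Fin.sum_univ_castSucc, add_assoc]
    · congr 1
      refine hd.eq_add (hT (Fin.last m)) ?_ ?_
      · convert ha (Fin.last m) using 1
        ext x
        refine and_congr_left fun _ => and_congr_right fun _ => ⟨fun h i hi => ?_, fun h i => ?_⟩
        · exact Fin.castSucc_castPred i hi.ne ▸ h _
        · exact h _ i.castSucc_lt_last
      · convert hb using 1
        ext x
        exact and_assoc.trans (and_congr_right fun _ =>
          (Fin.forall_fin_succ' (P := fun i => x ∈ T i)).symm)
    · convert ha j.castSucc using 1
      ext x
      refine and_congr_left fun _ => and_congr_right fun _ => ⟨fun h i hi => ?_, fun h i hi => ?_⟩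
      · obtain ⟨i, rfl⟩ := Fin.exists_castSucc_eq.mpr (hi.trans j.castSucc_lt_last).ne
        exact h i (Fin.castSucc_lt_castSucc_iff.mp hi)
      · exact h _ (Fin.castSucc_lt_castSucc_iff.mpr hi)

/-! ### Affine varieties -/

/-- The affine variety `Spec A` of a finitely generated `k`-algebra `A`. -/
def specVariety (k : Type u) [Field k] (A : Type u) [CommRing A] [Algebra k A]
    [Algebra.FiniteType k A] : Variety k where
  obj := Over.mk (Spec.map (CommRingCat.ofHom (algebraMap k A)))
  property := by
    refine ⟨by dsimp; infer_instance, ?_, by dsimp; infer_instance⟩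
    dsimp
    rw [HasRingHomProperty.Spec_iff (P := @LocallyOfFiniteType)]
    exact (RingHom.finiteType_algebraMap (A := k) (B := A)).mpr inferInstance

/-- The class of `Spec A` in `K₀(Var_k)`. -/
def specCls (k : Type u) [Field k] (A : Type u) [CommRing A] [Algebra k A]
    [Algebra.FiniteType k A] : K0Var k := cls (specVariety k A)

section

variable {A B : Type u} [CommRing A] [Algebra k A] [Algebra.FiniteType k A]
  [CommRing B] [Algebra k B] [Algebra.FiniteType k B]

/-- The morphism `Spec B ⟶ Spec A` of a homomorphism `A → B` of `k`-algebras. -/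
def specMap (φ : A →ₐ[k] B) : specVariety k B ⟶ specVariety k A :=
  Variety.homMk (Spec.map (CommRingCat.ofHom φ.toRingHom)) (by
    change Spec.map _ ≫ Spec.map _ = Spec.map _
    rw [← Spec.map_comp, ← CommRingCat.ofHom_comp]
    congr 2
    exact φ.comp_algebraMap)

/-- The locally closed subset `V(E) ∖ V(s)` of `Spec A`. -/
def specCell (k : Type u) [Field k] {A : Type u} [CommRing A] [Algebra k A]
    [Algebra.FiniteType k A] (E : Set A) (s : A) : Set (specVariety k A).obj.left :=
  {p : PrimeSpectrum A | E ⊆ p.asIdeal ∧ s ∉ p.asIdeal}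

/-- If `φ : A → B` exhibits `B` as the localization of `A ⧸ (E)` at `s`, then `Spec B` is immersed
in `Spec A` with image `V(E) ∖ V(s)`. The localization is expressed by elements, to be checked
without a construction of `A ⧸ (E)`. -/
theorem isClassOf_specCell (φ : A →ₐ[k] B) {E : Set A} {s : A} (hs : IsUnit (φ s))
    (hsurj : ∀ y, ∃ n a, φ s ^ n * y = φ a) (hE : ∀ a ∈ E, φ a = 0)
    (hker : ∀ a, φ a = 0 → ∃ m, s ^ m * a ∈ Ideal.span E) :
    IsClassOf (specVariety k A) (specCell k E s) (specCls k B) := by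
  let l : Localization.Away s →+* B := IsLocalization.Away.lift s (g := φ.toRingHom) hs
  have hl (a : A) : l (algebraMap _ _ a) = φ a := IsLocalization.Away.lift_eq s hs a
  have hlc : l.comp (algebraMap A (Localization.Away s)) = φ.toRingHom := RingHom.ext hl
  have hlsurj : Function.Surjective l := by
    intro y
    obtain ⟨n, a, h⟩ := hsurj y
    refine ⟨IsLocalization.mk' _ a (⟨s ^ n, n, rfl⟩ : Submonoid.powers s), ?_⟩
    refine (hs.pow n).mul_left_cancel ?_
    rw [h, ← hl a, ← IsLocalization.mk'_spec' (Localization.Away s) a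
      (⟨s ^ n, n, rfl⟩ : Submonoid.powers s), map_mul, hl, map_pow]
  have hfac : (specMap φ).hom.left = Spec.map (CommRingCat.ofHom l) ≫
      Spec.map (CommRingCat.ofHom (algebraMap A (Localization.Away s))) := by
    rw [← Spec.map_comp, ← CommRingCat.ofHom_comp, hlc]
    rfl
  refine ⟨specVariety k B, specMap φ, ?_, ?_, rfl⟩
  · have h₁ := (IsClosedImmersion.iff_isPreimmersion.mp
      (IsClosedImmersion.spec_of_surjective (CommRingCat.ofHom l) hlsurj)).1
    have h₂ := IsPreimmersion.of_isLocalization (Submonoid.powers s) (S := Localization.Away s)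
    rw [hfac]
    exact IsPreimmersion.instIsMultiplicativeScheme.comp_mem _ _ h₁ h₂
  · change Set.range (PrimeSpectrum.comap φ.toRingHom) = _
    refine Set.Subset.antisymm ?_ ?_
    · rintro _ ⟨q, rfl⟩
      refine ⟨fun a ha => ?_, fun h => q.isPrime.ne_top (Ideal.eq_top_of_isUnit_mem _ h hs)⟩
      change φ a ∈ q.asIdeal
      rw [hE a ha]
      exact zero_mem _
    · rintro (p : PrimeSpectrum A) ⟨hp, hps⟩
      have hr := PrimeSpectrum.localization_away_comap_range (Localization.Away s) s
      obtain ⟨q, rfl⟩ : p ∈ Set.range (PrimeSpectrum.comap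
        (algebraMap A (Localization.Away s))) := by rw [hr]; exact hps
      have hq : q ∈ Set.range (PrimeSpectrum.comap l) := by
        rw [range_comap_of_surjective _ _ hlsurj]
        intro z hz
        obtain ⟨⟨a, t⟩, hat⟩ := IsLocalization.surj (Submonoid.powers s) z
        dsimp only at hat
        have h0 : φ a = 0 := by
          rw [← hl, ← hat, map_mul, (RingHom.mem_ker).mp hz, zero_mul]
        obtain ⟨m, hm⟩ := hker a h0
        have ha := (q.comap (algebraMap A (Localization.Away s))).isPrime.mem_or_mem
          (Ideal.span_le.mpr hp hm)
        have ha : algebraMap A (Localization.Away s) a ∈ q.asIdeal :=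
          ha.resolve_left fun h => hps (Ideal.IsPrime.mem_of_pow_mem inferInstance _ h)
        rw [← hat] at ha
        exact (q.isPrime.mem_or_mem ha).resolve_right fun h => q.isPrime.ne_top
          (Ideal.eq_top_of_isUnit_mem _ h (IsLocalization.map_units _ t))
      obtain ⟨r, rfl⟩ := hq
      refine ⟨r, ?_⟩
      rw [← hlc]
      rfl

/-- A quotient of `A` by the ideal `(E)` gives the closed subset `V(E)`, written as
`V(E) ∖ V(1)`. -/
theorem isClassOf_of_surjective (φ : A →ₐ[k] B) {E : Set A} (hsurj : Function.Surjective φ)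
    (hker : RingHom.ker φ = Ideal.span E) :
    IsClassOf (specVariety k A) (specCell k E 1) (specCls k B) := by
  refine isClassOf_specCell φ (by rw [map_one]; exact isUnit_one) (fun y => ?_) (fun a ha => ?_)
    (fun a ha => ⟨0, ?_⟩)
  · obtain ⟨a, rfl⟩ := hsurj y
    exact ⟨0, a, by rw [pow_zero, one_mul]⟩
  · rw [← RingHom.mem_ker, hker]
    exact Ideal.subset_span ha
  · rw [pow_zero, one_mul, ← hker]
    exact ha

theorem specCell_empty_one : specCell k (∅ : Set A) 1 = Set.univ :=
  Set.eq_univ_of_forall fun p : PrimeSpectrum A =>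
    ⟨Set.empty_subset _, fun h => p.isPrime.ne_top ((Ideal.eq_top_iff_one _).mpr h)⟩

theorem specCls_congr (e : A ≃ₐ[k] B) : specCls k A = specCls k B := by
  refine (isClassOf_univ (specVariety k A)).unique ?_
  rw [← specCell_empty_one]
  refine isClassOf_of_surjective e.toAlgHom e.surjective ?_
  rw [Ideal.span_empty]
  exact (RingHom.injective_iff_ker_eq_bot _).mp e.injective

theorem isClosed_specZeroLocus (E : Set A) :
    IsClosed (X := (specVariety k A).obj.left) (PrimeSpectrum.zeroLocus E) :=
  PrimeSpectrum.isClosed_zeroLocus E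

/-- The class of `𝔸¹ × Spec A`. The affine line is defined with the index type `PUnit`, in the
universe of `k`. -/
theorem specCls_mvPolynomial (k : Type u) [Field k] (A : Type u) [CommRing A] [Algebra k A]
    [Algebra.FiniteType k A] :
    specCls k (MvPolynomial PUnit.{u + 1} A) = lefschetz k * specCls k A := by
  have hmul : lefschetz k * specCls k A = cls (affineLine k ⊗ specVariety k A) := by
    rw [lefschetz, specCls, cls, cls, cls, ← map_mul, freeClass_mul]
  rw [hmul]
  have hp := AffineSpace.isPullback_map (n := PUnit.{u + 1})
    (Spec.map (CommRingCat.ofHom (algebraMap k A)))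
  let f : Spec (.of (MvPolynomial PUnit.{u + 1} A)) ⟶
      (affineLine k ⊗ specVariety k A).obj.left :=
    (AffineSpace.SpecIso PUnit.{u + 1} (.of A)).inv ≫ hp.isoPullback.hom
  have hf : f ≫ (affineLine k ⊗ specVariety k A).obj.hom =
      (specVariety k (MvPolynomial PUnit.{u + 1} A)).obj.hom := by
    have key : (AffineSpace.SpecIso PUnit.{u + 1} (.of A)).inv ≫ hp.isoPullback.hom ≫
        Limits.pullback.fst _ _ ≫ (𝔸(PUnit.{u + 1}; Spec (.of k)) ↘ Spec (.of k)) =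
        Spec.map (CommRingCat.ofHom (algebraMap k (MvPolynomial PUnit.{u + 1} A))) := by
      rw [hp.isoPullback_hom_fst_assoc, AffineSpace.map_over,
        AffineSpace.SpecIso_inv_over_assoc, ← Spec.map_comp]
      rfl
    exact key
  have hiso : IsIso f :=
    IsIso.comp_isIso' (AffineSpace.SpecIso PUnit.{u + 1} (.of A)).isIso_inv
      hp.isoPullback.isIso_hom
  refine (cls_eq_of_surjective (Variety.homMk f hf) ?_ ?_).symm
  · change IsPreimmersion f; infer_instance
  · change Function.Surjective f; exact f.surjective

/-- The class of `𝔸¹ × Spec A` is a multiple of `𝕃`. -/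
theorem specCls_polynomial_mem (k : Type u) [Field k] (A : Type u) [CommRing A] [Algebra k A]
    [Algebra.FiniteType k A] :
    specCls k (Polynomial A) ∈ Ideal.span {lefschetz k} := by
  rw [← specCls_congr ((MvPolynomial.uniqueAlgEquiv A PUnit.{u + 1}).restrictScalars k),
    specCls_mvPolynomial]
  exact Ideal.mul_mem_right _ _ (Ideal.mem_span_singleton_self _)

end

/-! ### Hypersurfaces with a linear equation -/

section

variable {A : Type u} [CommRing A] [Algebra k A] [Algebra.FiniteType k A]

instance finiteType_localization_away (s : A) : Algebra.FiniteType k (Localization.Away s) :=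
  .trans (S := A) inferInstance (IsLocalization.finiteType_of_monoid_fg (.powers s) _)

/-- The scissor relation for the closed subset `V(s)` of `V(E)`. -/
theorem eq_add_of_specCell {E : Set A} {s : A} {c a b : K0Var k}
    (hc : IsClassOf (specVariety k A) (specCell k E 1) c)
    (ha : IsClassOf (specVariety k A) (specCell k E s) a)
    (hb : IsClassOf (specVariety k A) (specCell k (insert s E) 1) b) : c = a + b := by
  have h1 (p : PrimeSpectrum A) : (1 : A) ∉ p.asIdeal :=
    fun h => p.isPrime.ne_top ((Ideal.eq_top_iff_one _).mpr h)
  refine hc.eq_add (isClosed_specZeroLocus {s}) ?_ ?_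
  · convert ha using 1
    ext p
    change ((_ ∧ _) ∧ ¬ ({s} : Set A) ⊆ _) ↔ (_ ∧ _)
    rw [Set.singleton_subset_iff]
    exact ⟨fun h => ⟨h.1.1, h.2⟩, fun h => ⟨⟨h.1, h1 p⟩, h.2⟩⟩
  · convert hb using 1
    ext p
    change ((_ ∧ _) ∧ ({s} : Set A) ⊆ _) ↔ (_ ∧ _)
    rw [Set.singleton_subset_iff, Set.insert_subset_iff]
    exact ⟨fun h => ⟨⟨h.2, h.1.1⟩, h1 p⟩, fun h => ⟨⟨h.1.2, h1 p⟩, h.1.1⟩⟩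

theorem isClassOf_quotient (I : Ideal A) {E : Set A} (hI : I = Ideal.span E) :
    IsClassOf (specVariety k A) (specCell k E 1) (specCls k (A ⧸ I)) :=
  isClassOf_of_surjective (Ideal.Quotient.mkₐ k I) (Ideal.Quotient.mkₐ_surjective k I)
    ((Ideal.Quotient.mkₐ_ker k I).trans hI)

theorem isClassOf_localization_away (s : A) :
    IsClassOf (specVariety k A) (specCell k ∅ s) (specCls k (Localization.Away s)) := by
  refine isClassOf_specCell (IsScalarTower.toAlgHom k A (Localization.Away s))
    (IsLocalization.Away.algebraMap_isUnit s) (fun y => ?_) (fun a h => h.elim) (fun a h => ?_)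
  · obtain ⟨n, a, h⟩ := IsLocalization.Away.surj s y
    exact ⟨n, a, by rw [mul_comm]; exact h⟩
  · obtain ⟨⟨_, m, rfl⟩, h⟩ := (IsLocalization.map_eq_zero_iff (.powers s) _ a).mp h
    exact ⟨m, by rw [h]; exact zero_mem _⟩

theorem specCls_eq_add (s : A) :
    specCls k A = specCls k (Localization.Away s) + specCls k (A ⧸ Ideal.span {s}) := by
  refine eq_add_of_specCell (E := ∅) (s := s) ?_ (isClassOf_localization_away s) ?_
  · rw [specCell_empty_one]
    exact isClassOf_univ _
  · rw [LawfulSingleton.insert_empty_eq]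
    exact isClassOf_quotient _ rfl

open Polynomial in
/-- After multiplication by a power of `q`, every polynomial is constant modulo `q t + c`. -/
theorem exists_pow_mul_sub_C_mem_span {A : Type*} [CommRing A] (q c : A) (a : A[X]) :
    ∃ m r, C q ^ m * a - C r ∈ Ideal.span {C q * X + C c} := by
  induction a using Polynomial.induction_on' with
  | add a b ha hb =>
    obtain ⟨m, r, h⟩ := ha
    obtain ⟨n, s, h'⟩ := hb
    refine ⟨m + n, q ^ n * r + q ^ m * s, ?_⟩
    convert add_mem (Ideal.mul_mem_left _ (C q ^ n) h) (Ideal.mul_mem_left _ (C q ^ m) h') using 1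
    simp only [map_add, map_mul, map_pow]
    ring
  | monomial n b =>
    refine ⟨n, b * (-c) ^ n, ?_⟩
    rw [Ideal.mem_span_singleton]
    have h : C q * X + C c ∣ (C q * X) ^ n - (C (-c)) ^ n := by
      convert sub_dvd_pow_sub_pow (C q * X) (C (-c)) n using 1
      rw [C_neg, sub_neg_eq_add]
    convert h.mul_left (C b) using 1
    rw [← C_mul_X_pow_eq_monomial, C_mul, C_pow]
    ring

open Polynomial in
/-- The hypersurface `q t + c = 0` in `𝔸¹ × Spec A` is the graph of `-c / q` over `q ≠ 0` and a
product with the affine line over `q = c = 0`. -/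
theorem specCls_linear (q c : A) :
    specCls k (A[X] ⧸ Ideal.span {C q * X + C c}) =
      specCls k (Localization.Away q) + specCls k (A ⧸ Ideal.span {q, c})[X] := by
  refine eq_add_of_specCell (s := C q) (isClassOf_quotient _ rfl) ?_ ?_
  -- The section `t = -c / q` over `q ≠ 0`.
  · let z : Localization.Away q := IsLocalization.mk' _ (-c) (⟨q, 1, pow_one q⟩ : Submonoid.powers q)
    have hz : algebraMap A _ q * z = - algebraMap A _ c := by
      rw [← map_neg]
      exact IsLocalization.mk'_spec' _ (-c) (⟨q, 1, pow_one q⟩ : Submonoid.powers q)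
    let φ : A[X] →ₐ[k] Localization.Away q := (aeval z).restrictScalars k
    have hφC (a : A) : φ (C a) = algebraMap A _ a := aeval_C z a
    have hφ : φ (C q * X + C c) = 0 := by
      rw [map_add, map_mul, hφC, hφC, show φ X = z from aeval_X z, hz, neg_add_cancel]
    refine isClassOf_specCell φ ?_ (fun y => ?_) ?_ (fun a ha => ?_)
    · rw [hφC]
      exact IsLocalization.Away.algebraMap_isUnit q
    · obtain ⟨n, a, h⟩ := IsLocalization.Away.surj q y
      exact ⟨n, C a, by rw [hφC, hφC, mul_comm, h]⟩
    · rintro _ rfl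
      exact hφ
    -- Up to a power of `q`, the polynomial `a` is the constant `r`, which vanishes in `A_q`.
    · obtain ⟨m, r, h⟩ := exists_pow_mul_sub_C_mem_span q c a
      have hr : algebraMap A (Localization.Away q) r = 0 := by
        obtain ⟨b, hb⟩ := Ideal.mem_span_singleton.mp h
        have := congrArg φ hb
        rwa [map_mul φ (_ + _), hφ, zero_mul, map_sub, map_mul, ha, mul_zero, zero_sub,
          neg_eq_zero, hφC] at this
      obtain ⟨⟨_, n, rfl⟩, hn⟩ := (IsLocalization.map_eq_zero_iff (.powers q) _ r).mp hr
      refine ⟨n + m, ?_⟩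
      convert Ideal.mul_mem_left _ (C q ^ n) h using 1
      have hr0 : C q ^ n * C r = 0 := by
        rw [← C_pow, ← C_mul, show q ^ n * r = 0 from hn, C_0]
      rw [mul_sub, hr0, sub_zero, pow_add, mul_assoc]
  · refine isClassOf_of_surjective (mapAlgHom (Ideal.Quotient.mkₐ k (Ideal.span {q, c})))
      (map_surjective _ Ideal.Quotient.mk_surjective) ?_
    change RingHom.ker (mapRingHom (Ideal.Quotient.mk (Ideal.span {q, c}))) = _
    rw [ker_mapRingHom, Ideal.mk_ker, Ideal.map_span, Set.image_pair]
    refine le_antisymm (Ideal.span_le.mpr ?_) (Ideal.span_le.mpr ?_)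
    · have hq : C q ∈ Ideal.span {C q, C q * X + C c} := Ideal.subset_span (by simp)
      rintro _ (rfl | rfl)
      · exact hq
      · have hF : C q * X + C c ∈ Ideal.span {C q, C q * X + C c} := Ideal.subset_span (by simp)
        simpa using sub_mem hF (Ideal.mul_mem_right X _ hq)
    · have hq : C q ∈ Ideal.span {C q, C c} := Ideal.subset_span (by simp)
      rintro _ (rfl | rfl)
      · exact hq
      · exact add_mem (Ideal.mul_mem_right X _ hq) (Ideal.subset_span (by simp))

/-- The class of `Spec A` in the quotient of `K₀(Var_k)` by the ideal of `𝕃`. -/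
def specClsModL (k : Type u) [Field k] (A : Type u) [CommRing A] [Algebra k A]
    [Algebra.FiniteType k A] : K0Var k ⧸ Ideal.span {lefschetz k} :=
  Ideal.Quotient.mk _ (specCls k A)

theorem specClsModL_polynomial : specClsModL k (Polynomial A) = 0 :=
  Ideal.Quotient.eq_zero_iff_mem.mpr (specCls_polynomial_mem k A)

theorem specClsModL_congr {B : Type u} [CommRing B] [Algebra k B] [Algebra.FiniteType k B]
    (e : A ≃ₐ[k] B) : specClsModL k A = specClsModL k B :=
  congrArg _ (specCls_congr e)

theorem specClsModL_quotient_congr {B : Type u} [CommRing B] [Algebra k B]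
    [Algebra.FiniteType k B] (e : A ≃ₐ[k] B) (a : A) :
    specClsModL k (A ⧸ Ideal.span {a}) = specClsModL k (B ⧸ Ideal.span {e a}) :=
  specClsModL_congr (Ideal.quotientEquivAlg _ _ e (by rw [Ideal.map_span, Set.image_singleton]; rfl))

open Polynomial in
/-- Modulo `𝕃`, the hypersurface `q t + c = 0` has the class of the complement of `q = 0`. -/
theorem specClsModL_linear (q c : A) :
    specClsModL k (A[X] ⧸ Ideal.span {C q * X + C c}) =
      specClsModL k A - specClsModL k (A ⧸ Ideal.span {q}) := by
  have h : specClsModL k A = _ := congrArg (Ideal.Quotient.mk _) (specCls_eq_add (k := k) q)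
  have h' : specClsModL k (A[X] ⧸ Ideal.span {C q * X + C c}) = _ :=
    congrArg (Ideal.Quotient.mk _) (specCls_linear (k := k) q c)
  rw [map_add] at h h'
  rw [h, h', show Ideal.Quotient.mk _ (specCls k (A ⧸ Ideal.span {q, c})[X]) = 0 from
    specClsModL_polynomial, add_zero]
  exact (add_sub_cancel_right _ _).symm

end

/-! ### Linear changes of coordinates and forms with a rational point -/

section Coordinates

open MvPolynomial

/-- The value of a form at a coordinate vector is the coefficient of the pure power. -/
theorem eval_single_of_isHomogeneous {σ R : Type*} [Fintype σ] [DecidableEq σ] [CommSemiring R]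
    {F : MvPolynomial σ R} {d : ℕ} (hF : F.IsHomogeneous d) (i : σ) :
    eval (Pi.single i 1) F = coeff (Finsupp.single i d) F := by
  rw [eval_eq', Finset.sum_eq_single (Finsupp.single i d)]
  · rw [Finset.prod_eq_one, mul_one]
    intro j _
    rcases eq_or_ne j i with rfl | h
    · rw [Pi.single_eq_same, one_pow]
    · rw [Finsupp.single_eq_of_ne h, pow_zero]
  · intro m hm hne
    have hdeg : m.degree = d := by
      by_contra h
      exact mem_support_iff.mp hm (hF.coeff_eq_zero h)
    obtain ⟨j, hji, hj⟩ : ∃ j, j ≠ i ∧ m j ≠ 0 := by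
      by_contra! h
      have hm' : m = Finsupp.single i (m i) := by
        ext j
        rcases eq_or_ne j i with rfl | hj
        · exact (Finsupp.single_eq_same).symm
        · rw [Finsupp.single_eq_of_ne hj, h j hj]
      have hi : m i = d := by
        rw [← hdeg]
        conv_rhs => rw [hm', Finsupp.degree_single]
      exact hne (by rw [hm', hi])
    rw [Finset.prod_eq_zero (Finset.mem_univ j), mul_zero]
    rw [Pi.single_eq_of_ne hji, zero_pow hj]
  · intro h
    rw [notMem_support_iff.mp h, zero_mul]

theorem exists_linearEquiv_apply_single {n : ℕ} {v : Fin (n + 1) → k} (hv : v ≠ 0) :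
    ∃ g : (Fin (n + 1) → k) ≃ₗ[k] (Fin (n + 1) → k), g (Pi.single 0 1) = v := by
  have h0 : (Pi.single 0 1 : Fin (n + 1) → k) ≠ 0 := by simp
  obtain ⟨g, hg⟩ := Submodule.exists_linearEquiv_restrict_eq
    ((LinearEquiv.toSpanNonzeroSingleton k _ _ h0).symm ≪≫ₗ
      LinearEquiv.toSpanNonzeroSingleton k _ v hv)
  refine ⟨g, ?_⟩
  have := hg (LinearEquiv.toSpanNonzeroSingleton k _ _ h0 1)
  rw [LinearEquiv.trans_apply, LinearEquiv.symm_apply_apply] at this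
  simpa using this.symm

/-- The substitution of linear forms, given by the rows of a matrix, for the variables. -/
def linearSubst {σ : Type*} [Fintype σ] (M : Matrix σ σ k) :
    MvPolynomial σ k →ₐ[k] MvPolynomial σ k := bind₁ M.toMvPolynomial

theorem linearSubst_comp {σ : Type*} [Fintype σ] [DecidableEq σ] {M N : Matrix σ σ k}
    (h : M * N = 1) : (linearSubst N).comp (linearSubst M) = AlgHom.id k _ := by
  refine MvPolynomial.algHom_ext fun i => ?_
  rw [AlgHom.comp_apply, linearSubst, linearSubst, bind₁_X_right, ← Matrix.toMvPolynomial_mul, h,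
    Matrix.toMvPolynomial_one]
  rfl

theorem eval_linearSubst {σ : Type*} [Fintype σ] (M : Matrix σ σ k) (x : σ → k)
    (F : MvPolynomial σ k) : eval x (linearSubst M F) = eval (M.mulVec x) F := by
  rw [linearSubst, MvPolynomial.eval, eval₂Hom_bind₁]
  congr 2
  funext i
  exact M.toMvPolynomial_eval_eq_apply i x

/-- The chain rule for a linear substitution. -/
theorem eval_pderiv_linearSubst {σ : Type*} [Fintype σ] [DecidableEq σ] (M : Matrix σ σ k)
    (x : σ → k) (i : σ) (F : MvPolynomial σ k) :
    eval x (pderiv i (linearSubst M F)) = ∑ l, eval (M.mulVec x) (pderiv l F) * M l i := by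
  induction F using MvPolynomial.induction_on with
  | C a => simp [linearSubst]
  | add p q hp hq => simp only [map_add, hp, hq, add_mul, Finset.sum_add_distrib]
  | mul_X p j hp =>
    have hj : eval x (pderiv i (linearSubst M (X j))) = M j i := by
      rw [linearSubst, bind₁_X_right, Matrix.toMvPolynomial]
      simp [pderiv_monomial, Finsupp.single_apply, eval_monomial]
    rw [map_mul, Derivation.leibniz, map_add, smul_eq_mul, smul_eq_mul, map_mul, map_mul, hj, hp,
      eval_linearSubst, eval_linearSubst]
    simp only [Derivation.leibniz, map_add, smul_eq_mul, map_mul, eval_X, add_mul,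
      Finset.sum_add_distrib, pderiv_X]
    simp [Pi.single_apply, Finset.mul_sum, apply_ite, mul_assoc]

/-- A linear change of coordinates which moves the point `v` to `(1, 0, …, 0)`. -/
theorem exists_linear_algEquiv {n : ℕ} {v : Fin (n + 1) → k} (hv : v ≠ 0) :
    ∃ e : MvPolynomial (Fin (n + 1)) k ≃ₐ[k] MvPolynomial (Fin (n + 1)) k,
      (∀ F d, F.IsHomogeneous d → (e F).IsHomogeneous d) ∧
      (∀ F, eval (Pi.single 0 1) (e F) = eval v F) ∧
      ∀ F, (∀ i, eval v (pderiv i F) = 0) → ∀ i, eval (Pi.single 0 1) (pderiv i (e F)) = 0 := by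
  obtain ⟨g, hg⟩ := exists_linearEquiv_apply_single hv
  let M := LinearMap.toMatrix' g.toLinearMap
  let N := LinearMap.toMatrix' g.symm.toLinearMap
  have hMN : M * N = 1 := by
    rw [← LinearMap.toMatrix'_comp]
    simp
  have hNM : N * M = 1 := by
    rw [← LinearMap.toMatrix'_comp]
    simp
  have hM : M.mulVec (Pi.single 0 1) = v := by
    rw [← hg, LinearMap.toMatrix'_mulVec]
    rfl
  refine ⟨AlgEquiv.ofAlgHom (linearSubst M) (linearSubst N) (linearSubst_comp hNM)
    (linearSubst_comp hMN), fun F d hF => ?_, fun F => ?_, fun F h i => ?_⟩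
  · have := hF.aeval M.toMvPolynomial M.toMvPolynomial_isHomogeneous
    rwa [one_mul] at this
  · rw [AlgEquiv.ofAlgHom_apply, eval_linearSubst, hM]
  · rw [AlgEquiv.ofAlgHom_apply, eval_pderiv_linearSubst, hM]
    exact Finset.sum_eq_zero fun l _ => by rw [h l, zero_mul]

variable {n d : ℕ} {F : MvPolynomial (Fin (n + 1)) k}

theorem degree_cons (i : ℕ) (m : Fin n →₀ ℕ) : (m.cons i).degree = i + m.degree := by
  simp [Finsupp.degree_eq_sum, Fin.sum_univ_succ]

theorem coeff_finSuccEquiv_eq_zero_of_lt (hF : F.IsHomogeneous d) {i : ℕ} (hi : d < i) :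
    (finSuccEquiv k n F).coeff i = 0 := by
  ext m
  rw [finSuccEquiv_coeff_coeff, coeff_zero]
  refine hF.coeff_eq_zero ?_
  rw [degree_cons]
  omega

/-- A form of degree `d` that vanishes at `(1, 0, …, 0)` has no term in `x₀ ^ d`. -/
theorem coeff_finSuccEquiv_eq_zero_of_eval (hF : F.IsHomogeneous d)
    (h : eval (Pi.single 0 1) F = 0) : (finSuccEquiv k n F).coeff d = 0 := by
  rw [eval_single_of_isHomogeneous hF] at h
  ext m
  rw [finSuccEquiv_coeff_coeff, coeff_zero]
  by_cases hm : m = 0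
  · subst hm
    convert h
    ext j
    refine Fin.cases ?_ (fun j => ?_) j <;> simp
  · refine hF.coeff_eq_zero ?_
    rw [degree_cons]
    have := mt (Finsupp.degree_eq_zero_iff m).mp hm
    omega

/-- A form of degree `d + 1` whose partial derivatives vanish at `(1, 0, …, 0)` has no term in
`x₀ ^ d`: the coefficient of `x₀ ^ d xⱼ` is the value of the `j`-th derivative there. -/
theorem coeff_finSuccEquiv_eq_zero_of_pderiv (hF : F.IsHomogeneous (d + 1))
    (h : ∀ i, eval (Pi.single 0 1) (pderiv i F) = 0) : (finSuccEquiv k n F).coeff d = 0 := by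
  ext m
  rw [finSuccEquiv_coeff_coeff, coeff_zero]
  by_contra hm
  have hdeg : m.degree = 1 := by
    by_contra h
    refine hm (hF.coeff_eq_zero ?_)
    rw [degree_cons]
    omega
  obtain ⟨j, rfl⟩ : ∃ j, m = Finsupp.single j 1 := (Finsupp.sum_eq_one_iff m).mp hdeg
  have := h j.succ
  have hp : (pderiv j.succ F).IsHomogeneous d := by simpa using hF.pderiv (i := j.succ)
  rw [eval_single_of_isHomogeneous hp, coeff_pderiv] at this
  rw [Finsupp.single_eq_of_ne (Fin.succ_ne_zero j), Nat.cast_zero, zero_add, mul_one] at this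
  refine hm ?_
  convert this using 2
  ext l
  refine Fin.cases ?_ (fun l => ?_) l <;> simp [Finsupp.single_apply]

variable (k n) in
theorem specClsModL_mvPolynomial_succ :
    specClsModL k (MvPolynomial (Fin (n + 1)) k) = 0 := by
  rw [specClsModL_congr (finSuccEquiv k n), specClsModL_polynomial]

/-- The case of `specClsModL_linear` in which the equation is a polynomial of degree at most one in
its first variable. -/
theorem specClsModL_of_coeff (hF : ∀ i, 1 < i → (finSuccEquiv k n F).coeff i = 0) :
    specClsModL k (MvPolynomial (Fin (n + 1)) k ⧸ Ideal.span {F}) =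
      specClsModL k (MvPolynomial (Fin n) k) - specClsModL k (MvPolynomial (Fin n) k ⧸
        Ideal.span {(finSuccEquiv k n F).coeff 1}) := by
  have h : finSuccEquiv k n F = Polynomial.C ((finSuccEquiv k n F).coeff 1) * Polynomial.X +
      Polynomial.C ((finSuccEquiv k n F).coeff 0) :=
    Polynomial.eq_X_add_C_of_natDegree_le_one (Polynomial.natDegree_le_iff_coeff_eq_zero.mpr hF)
  rw [← specClsModL_linear, ← h, specClsModL_quotient_congr (finSuccEquiv k n) F]

/-- A linear form with a nontrivial zero does not, in suitable coordinates, involve the first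
variable, so its zero set is the product of a line and another variety. -/
theorem specClsModL_linearForm {l : MvPolynomial (Fin (n + 2)) k} (hl : l.IsHomogeneous 1)
    {v : Fin (n + 2) → k} (hv : v ≠ 0) (h : eval v l = 0) :
    specClsModL k (MvPolynomial (Fin (n + 2)) k ⧸ Ideal.span {l}) = 0 := by
  obtain ⟨e, he, hev, -⟩ := exists_linear_algEquiv hv
  have h1 := coeff_finSuccEquiv_eq_zero_of_eval (he l 1 hl) (by rw [hev, h])
  rw [specClsModL_quotient_congr e, specClsModL_of_coeff fun i hi =>
    coeff_finSuccEquiv_eq_zero_of_lt (he l 1 hl) hi, h1, Set.singleton_zero, Ideal.span_zero,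
    specClsModL_congr (AlgEquiv.quotientBot k (MvPolynomial (Fin (n + 1)) k)), sub_self]

/-- The affine cone over a quadric with a rational point has class `0` modulo `𝕃`: in suitable
coordinates the quadratic form is `y₀ l + r`, and the linear form `l` has a nontrivial zero by the
`C1` property. -/
theorem specClsModL_quadric (hk : IsC1Field k) {q : MvPolynomial (Fin (n + 3)) k}
    (hq : q.IsHomogeneous 2) {v : Fin (n + 3) → k} (hv : v ≠ 0) (h : eval v q = 0) :
    specClsModL k (MvPolynomial (Fin (n + 3)) k ⧸ Ideal.span {q}) = 0 := by
  obtain ⟨e, he, hev, -⟩ := exists_linear_algEquiv hv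
  have h2 := coeff_finSuccEquiv_eq_zero_of_eval (he q 2 hq) (by rw [hev, h])
  have hl := (he q 2 hq).finSuccEquiv_coeff_isHomogeneous 1 1 rfl
  obtain ⟨w, hw, hw0⟩ := hk (n + 1) 1 le_rfl (by omega) _ hl
  rw [specClsModL_quotient_congr e, specClsModL_of_coeff, specClsModL_mvPolynomial_succ,
    specClsModL_linearForm hl hw hw0, sub_zero]
  intro i hi
  rcases (Nat.succ_le_of_lt hi).eq_or_lt with rfl | hi
  · exact h2
  · exact coeff_finSuccEquiv_eq_zero_of_lt (he q 2 hq) hi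

/-- The affine cone over a cubic with a rational singular point has class `0` modulo `𝕃`: in suitable
coordinates the cubic form is `x₀ q + c`, and the quadratic form `q` has a nontrivial zero by the
`C1` property. -/
theorem specClsModL_cubic (hk : IsC1Field k) {f : MvPolynomial (Fin (n + 4)) k}
    (hf : f.IsHomogeneous 3) {v : Fin (n + 4) → k} (hv : v ≠ 0) (h : eval v f = 0)
    (h' : ∀ i, eval v (pderiv i f) = 0) :
    specClsModL k (MvPolynomial (Fin (n + 4)) k ⧸ Ideal.span {f}) = 0 := by
  obtain ⟨e, he, hev, hed⟩ := exists_linear_algEquiv hv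
  have h3 := coeff_finSuccEquiv_eq_zero_of_eval (he f 3 hf) (by rw [hev, h])
  have h2 := coeff_finSuccEquiv_eq_zero_of_pderiv (he f 3 hf) (hed f h')
  have hq := (he f 3 hf).finSuccEquiv_coeff_isHomogeneous 1 2 rfl
  obtain ⟨w, hw, hw0⟩ := hk (n + 2) 2 one_le_two (by omega) _ hq
  rw [specClsModL_quotient_congr e, specClsModL_of_coeff, specClsModL_mvPolynomial_succ,
    specClsModL_quadric hk hq hw hw0, sub_zero]
  intro i hi
  rcases (Nat.succ_le_of_lt hi).eq_or_lt with rfl | hi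
  · exact h2
  rcases (Nat.succ_le_of_lt hi).eq_or_lt with rfl | hi
  · exact h3
  · exact coeff_finSuccEquiv_eq_zero_of_lt (he f 3 hf) hi

end Coordinates

/-! ### Charts and the punctured affine cone -/

section Charts

open MvPolynomial

variable {n : ℕ}

/-- The coordinate ring of the part of the closed set `V(E)` of projective space that lies in the
chart `xⱼ = 1`. -/
abbrev Chart (E : Set (MvPolynomial (Fin (n + 1)) k)) (j : Fin (n + 1)) : Type u :=
  MvPolynomial (Fin (n + 1)) k ⧸ Ideal.span (insert (X j - 1) E)

/-- The restriction of polynomials to the chart `xⱼ = 1` of `V(E)`. -/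
def toChart (E : Set (MvPolynomial (Fin (n + 1)) k)) (j : Fin (n + 1)) :
    MvPolynomial (Fin (n + 1)) k →ₐ[k] Chart E j := Ideal.Quotient.mkₐ k _

variable {E : Set (MvPolynomial (Fin (n + 1)) k)} {j : Fin (n + 1)}

theorem toChart_surjective : Function.Surjective (toChart E j) := Ideal.Quotient.mkₐ_surjective _ _

theorem toChart_eq_zero_iff {a : MvPolynomial (Fin (n + 1)) k} :
    toChart E j a = 0 ↔ a ∈ Ideal.span (insert (X j - 1) E) := Ideal.Quotient.eq_zero_iff_mem

theorem toChart_X_self : toChart E j (X j) = 1 := by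
  rw [← sub_eq_zero, ← map_one (toChart E j), ← map_sub, toChart_eq_zero_iff]
  exact Ideal.subset_span (Set.mem_insert _ _)

theorem toChart_eq_zero {g : MvPolynomial (Fin (n + 1)) k} (hg : g ∈ E) : toChart E j g = 0 :=
  toChart_eq_zero_iff.mpr (Ideal.subset_span (Set.mem_insert_of_mem _ hg))

/-- A form of degree `d` scales with the `d`-th power. -/
theorem aeval_mul_of_isHomogeneous {σ R S : Type*} [Fintype σ] [CommSemiring R] [CommSemiring S]
    [Algebra R S] {p : MvPolynomial σ R} {d : ℕ} (hp : p.IsHomogeneous d) (c : S) (x : σ → S) :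
    aeval (fun i => x i * c) p = aeval x p * c ^ d := by
  rw [aeval_def, aeval_def, eval₂_eq', eval₂_eq', Finset.sum_mul]
  refine Finset.sum_congr rfl fun m hm => ?_
  have hdeg : ∑ i, m i = d := by
    by_contra h
    rw [← Finsupp.degree_eq_sum] at h
    exact mem_support_iff.mp hm (hp.coeff_eq_zero h)
  simp_rw [mul_pow]
  rw [Finset.prod_mul_distrib, Finset.prod_pow_eq_pow_sum, hdeg, mul_assoc]

/-- A homogeneous polynomial that vanishes on the chart `xⱼ = 1` of `V(E)` lies in the ideal `(E)`
once `xⱼ` is inverted: substitute `xᵢ / xⱼ` for `xᵢ`. -/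
theorem algebraMap_mem_of_toChart_eq_zero (hE : ∀ g ∈ E, ∃ d, g.IsHomogeneous d)
    {p : MvPolynomial (Fin (n + 1)) k} {m : ℕ} (hp : p.IsHomogeneous m) (h : toChart E j p = 0) :
    algebraMap _ (Localization.Away (X j : MvPolynomial (Fin (n + 1)) k)) p ∈
      (Ideal.span E).map
        (algebraMap _ (Localization.Away (X j : MvPolynomial (Fin (n + 1)) k))) := by
  set L := Localization.Away (X j : MvPolynomial (Fin (n + 1)) k)
  have hu : IsUnit (algebraMap (MvPolynomial (Fin (n + 1)) k) L (X j)) :=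
    IsLocalization.Away.algebraMap_isUnit _
  obtain ⟨u, hu⟩ := hu
  let δ : MvPolynomial (Fin (n + 1)) k →ₐ[k] L :=
    aeval fun i => algebraMap (MvPolynomial (Fin (n + 1)) k) L (X i) * (u⁻¹ : Lˣ)
  have hδ {p : MvPolynomial (Fin (n + 1)) k} {m : ℕ} (hp : p.IsHomogeneous m) :
      δ p = algebraMap _ L p * (u⁻¹ : Lˣ) ^ m := by
    refine (aeval_mul_of_isHomogeneous hp _ _).trans ?_
    congr 1
    have : (aeval fun i => algebraMap (MvPolynomial (Fin (n + 1)) k) L (X i)) =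
        IsScalarTower.toAlgHom k (MvPolynomial (Fin (n + 1)) k) L := by
      refine MvPolynomial.algHom_ext fun i => ?_
      rw [aeval_X]
      rfl
    rw [this]
    rfl
  have hle : Ideal.span (insert (X j - 1) E) ≤ ((Ideal.span E).map (algebraMap _ L)).comap δ := by
    refine Ideal.span_le.mpr ?_
    rintro g (rfl | hg)
    · have : δ (X j - 1) = 0 := by
        rw [map_sub, map_one, sub_eq_zero, hδ (isHomogeneous_X _ _), ← hu, pow_one, Units.mul_inv]
      change δ (X j - 1) ∈ (Ideal.span E).map (algebraMap _ L)
      rw [this]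
      exact zero_mem _
    · obtain ⟨d, hd⟩ := hE g hg
      change δ g ∈ (Ideal.span E).map (algebraMap _ L)
      rw [hδ hd]
      exact Ideal.mul_mem_right _ _ (Ideal.mem_map_of_mem _ (Ideal.subset_span hg))
  have hδp : δ p ∈ (Ideal.span E).map (algebraMap _ L) := hle (toChart_eq_zero_iff.mp h)
  rw [hδ hp] at hδp
  have := Ideal.mul_mem_right ((u : L) ^ m) _ hδp
  rwa [mul_assoc, ← mul_pow, Units.inv_mul, one_pow, mul_one] at this

theorem exists_X_pow_mul_mem {a : MvPolynomial (Fin (n + 1)) k} {I : Ideal _}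
    (h : algebraMap _ (Localization.Away (X j : MvPolynomial (Fin (n + 1)) k)) a ∈
      I.map (algebraMap _ (Localization.Away (X j : MvPolynomial (Fin (n + 1)) k)))) :
    ∃ N, X j ^ N * a ∈ I := by
  obtain ⟨_, ⟨N, rfl⟩, hN⟩ := (IsLocalization.algebraMap_mem_map_algebraMap_iff
    (.powers (X j : MvPolynomial (Fin (n + 1)) k)) _ _ _).mp h
  exact ⟨N, hN⟩

open Polynomial in
/-- The homomorphism of coordinate rings of the scaling morphism `(t, x) ↦ t x` from the product of
the affine line and the chart to affine space. -/
def scaling (E : Set (MvPolynomial (Fin (n + 1)) k)) (j : Fin (n + 1)) :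
    MvPolynomial (Fin (n + 1)) k →ₐ[k] (Chart E j)[X] :=
  MvPolynomial.aeval fun i => Polynomial.C (toChart E j (X i)) * Polynomial.X

theorem scaling_apply {p : MvPolynomial (Fin (n + 1)) k} {d : ℕ} (hp : p.IsHomogeneous d) :
    scaling E j p = Polynomial.C (toChart E j p) * Polynomial.X ^ d := by
  refine (aeval_mul_of_isHomogeneous hp _ _).trans ?_
  congr 1
  have : (aeval fun i => (Polynomial.C (toChart E j (X i)) : Polynomial (Chart E j))) =
      (Polynomial.CAlgHom (R := k) (A := Chart E j)).comp (toChart E j) := by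
    refine MvPolynomial.algHom_ext fun i => ?_
    rw [aeval_X]
    rfl
  rw [this]
  rfl

theorem scaling_X_self : scaling E j (X j) = Polynomial.X := by
  rw [scaling_apply (isHomogeneous_X _ _), toChart_X_self, Polynomial.C_1, one_mul, pow_one]

theorem coeff_scaling (a : MvPolynomial (Fin (n + 1)) k) (d : ℕ) :
    (scaling E j a).coeff d = toChart E j (homogeneousComponent d a) := by
  conv_lhs => rw [← sum_homogeneousComponent a]
  rw [map_sum, Polynomial.finsetSum_coeff]
  simp_rw [scaling_apply (homogeneousComponent_isHomogeneous _ a), Polynomial.coeff_C_mul_X_pow]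
  rw [Finset.sum_ite_eq]
  split_ifs with h
  · rfl
  · rw [homogeneousComponent_eq_zero, map_zero]
    simpa using h

/-- The scaling homomorphism is surjective after inverting the parameter `t`, the image of `xⱼ`. -/
theorem exists_X_pow_mul_eq_scaling (P : Polynomial (Chart E j)) :
    ∃ N a, Polynomial.X ^ N * P = scaling E j a := by
  have hmon (p : MvPolynomial (Fin (n + 1)) k) :
      ∃ N a, Polynomial.X ^ N * Polynomial.C (toChart E j p) = scaling E j a := by
    induction p using MvPolynomial.induction_on with
    | C c =>
      refine ⟨0, C c, ?_⟩
      rw [scaling_apply (isHomogeneous_C _ _)]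
      ring
    | add p q hp hq =>
      obtain ⟨N, a, ha⟩ := hp
      obtain ⟨M, b, hb⟩ := hq
      refine ⟨N + M, X j ^ M * a + X j ^ N * b, ?_⟩
      simp only [map_add, map_mul, map_pow, ← ha, ← hb, scaling_X_self]
      ring
    | mul_X p i hp =>
      obtain ⟨N, a, ha⟩ := hp
      refine ⟨N + 1, a * X i, ?_⟩
      rw [map_mul, map_mul, map_mul, ← ha, scaling_apply (isHomogeneous_X _ _)]
      ring
  induction P using Polynomial.induction_on' with
  | add p q hp hq =>
    obtain ⟨N, a, ha⟩ := hp
    obtain ⟨M, b, hb⟩ := hq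
    refine ⟨N + M, X j ^ M * a + X j ^ N * b, ?_⟩
    simp only [map_add, map_mul, map_pow, ← ha, ← hb, scaling_X_self]
    ring
  | monomial d b =>
    obtain ⟨p, rfl⟩ := toChart_surjective b
    obtain ⟨N, a, ha⟩ := hmon p
    refine ⟨N, X j ^ d * a, ?_⟩
    rw [map_mul, map_pow, scaling_X_self, ← ha, ← Polynomial.C_mul_X_pow_eq_monomial]
    ring

/-- The part `xⱼ ≠ 0` of the affine cone over `V(E)` is the product of the punctured affine line and
the chart `xⱼ = 1`. -/
theorem isClassOf_cone (hE : ∀ g ∈ E, ∃ d, g.IsHomogeneous d) :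
    IsClassOf (specVariety k (MvPolynomial (Fin (n + 1)) k)) (specCell k E (X j))
      (specCls k (Localization.Away (Polynomial.X : Polynomial (Chart E j)))) := by
  set L := Localization.Away (Polynomial.X : Polynomial (Chart E j))
  let ι : Polynomial (Chart E j) →ₐ[k] L := IsScalarTower.toAlgHom k (Polynomial (Chart E j)) L
  have hX : IsUnit (ι Polynomial.X) :=
    IsLocalization.Away.algebraMap_isUnit (S := L) (Polynomial.X : Polynomial (Chart E j))
  refine isClassOf_specCell (ι.comp (scaling E j)) ?_ (fun y => ?_) (fun g hg => ?_)
    (fun a ha => ?_)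
  · rwa [AlgHom.comp_apply, scaling_X_self]
  · obtain ⟨m, P, h⟩ := IsLocalization.Away.surj (Polynomial.X : Polynomial (Chart E j)) y
    obtain ⟨N, a, ha⟩ := exists_X_pow_mul_eq_scaling P
    refine ⟨N + m, a, ?_⟩
    rw [AlgHom.comp_apply, AlgHom.comp_apply, scaling_X_self, ← ha, map_mul, map_pow, pow_add,
      mul_assoc, mul_comm _ y]
    congr 1
  · obtain ⟨d, hd⟩ := hE g hg
    rw [AlgHom.comp_apply, scaling_apply hd, toChart_eq_zero hg, Polynomial.C_0, zero_mul, map_zero]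
  -- The homogeneous components of `a` vanish on the chart, since `t` is not a zero divisor.
  · have h0 : scaling E j a = 0 := by
      obtain ⟨⟨_, m, rfl⟩, h⟩ := (IsLocalization.map_eq_zero_iff
        (.powers (Polynomial.X : Polynomial (Chart E j))) L _).mp ha
      ext d
      have := congrArg (Polynomial.coeff · (d + m)) h
      simpa [Polynomial.coeff_X_pow_mul] using this
    refine exists_X_pow_mul_mem ?_
    rw [← sum_homogeneousComponent a, map_sum]
    refine sum_mem fun d _ => algebraMap_mem_of_toChart_eq_zero hE
      (homogeneousComponent_isHomogeneous d a) ?_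
    rw [← coeff_scaling, h0, Polynomial.coeff_zero]

/-- The punctured affine line has class `-1` modulo `𝕃`. -/
theorem specClsModL_punctured (A : Type u) [CommRing A] [Algebra k A] [Algebra.FiniteType k A] :
    specClsModL k (Localization.Away (Polynomial.X : Polynomial A)) = - specClsModL k A := by
  have h : specClsModL k (Polynomial A) = _ :=
    congrArg (Ideal.Quotient.mk _) (specCls_eq_add (k := k) (Polynomial.X : Polynomial A))
  rw [specClsModL_polynomial, map_add] at h
  have h' : specClsModL k (Polynomial A ⧸ Ideal.span {(Polynomial.X : Polynomial A)}) =
      specClsModL k A := by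
    have := specClsModL_congr ((Polynomial.quotientSpanXSubCAlgEquiv (0 : A)).restrictScalars k)
    rwa [Polynomial.C_0, sub_zero] at this
  rw [← h']
  exact eq_neg_of_add_eq_zero_left h.symm

end Charts

/-! ### Charts of projective space -/

section Proj

open MvPolynomial

variable {n : ℕ} {E : Set (MvPolynomial (Fin (n + 1)) k)} {j : Fin (n + 1)}

theorem isUnit_toChart_X_self : IsUnit ((toChart E j).toRingHom (X j)) := by
  change IsUnit (toChart E j (X j))
  rw [toChart_X_self]
  exact isUnit_one

/-- The restriction of functions on the chart `xⱼ ≠ 0` of projective space to the part of `V(E)`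
in it. -/
def awayToChart (E : Set (MvPolynomial (Fin (n + 1)) k)) (j : Fin (n + 1)) :
    HomogeneousLocalization.Away (homogeneousSubmodule (Fin (n + 1)) k) (X j) →+* Chart E j :=
  (IsLocalization.Away.lift (S := Localization.Away (X j : MvPolynomial (Fin (n + 1)) k)) (X j)
    (g := (toChart E j).toRingHom)
    isUnit_toChart_X_self).comp
    (algebraMap (HomogeneousLocalization.Away (homogeneousSubmodule (Fin (n + 1)) k) (X j))
      (Localization.Away (X j : MvPolynomial (Fin (n + 1)) k)))

theorem X_mem (j : Fin (n + 1)) :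
    (X j : MvPolynomial (Fin (n + 1)) k) ∈ homogeneousSubmodule (Fin (n + 1)) k 1 :=
  isHomogeneous_X _ _

theorem awayToChart_mk (m : ℕ) (p : MvPolynomial (Fin (n + 1)) k)
    (hp : p ∈ homogeneousSubmodule (Fin (n + 1)) k (m • 1)) :
    awayToChart E j (HomogeneousLocalization.Away.mk _ (X_mem j) m p hp) = toChart E j p := by
  have h : (Localization.mk p (⟨X j ^ m, m, rfl⟩ :
        Submonoid.powers (X j : MvPolynomial (Fin (n + 1)) k))) *
      algebraMap (MvPolynomial (Fin (n + 1)) k)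
        (Localization.Away (X j : MvPolynomial (Fin (n + 1)) k)) (X j) ^ m =
      algebraMap (MvPolynomial (Fin (n + 1)) k) _ p := by
    rw [Localization.mk_eq_mk', ← map_pow]
    exact IsLocalization.mk'_spec _ _ _
  rw [awayToChart, RingHom.comp_apply, HomogeneousLocalization.algebraMap_apply,
    HomogeneousLocalization.Away.val_mk]
  have h' := congrArg (IsLocalization.Away.lift
    (S := Localization.Away (X j : MvPolynomial (Fin (n + 1)) k)) (X j)
    (g := (toChart E j).toRingHom)
    isUnit_toChart_X_self) h
  rw [map_mul, map_pow, IsLocalization.Away.lift_eq, IsLocalization.Away.lift_eq] at h'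
  change _ * (toChart E j (X j)) ^ m = toChart E j p at h'
  have hone : toChart E j (X j) ^ m = 1 := by rw [toChart_X_self, one_pow]
  rwa [hone, mul_one] at h'

theorem awayToChart_surjective : Function.Surjective (awayToChart E j) := by
  intro b
  obtain ⟨p, rfl⟩ := toChart_surjective b
  change _ ∈ (awayToChart E j).range
  induction p using MvPolynomial.induction_on with
  | C c => exact ⟨_, awayToChart_mk 0 (C c) (isHomogeneous_C _ _)⟩
  | add p q hp hq => rw [map_add]; exact add_mem hp hq
  | mul_X p i hp =>
    rw [map_mul]
    exact mul_mem hp ⟨_, awayToChart_mk 1 (X i) (isHomogeneous_X _ _)⟩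

/-- `awayToChart` is a homomorphism of `k`-algebras, the constants being fractions of degree zero. -/
theorem awayToChart_comp_algebraMap :
    ((awayToChart E j).comp (HomogeneousLocalization.fromZeroRingHom _ _)).comp
      (algebraMap k (homogeneousSubmodule (Fin (n + 1)) k 0)) = algebraMap k (Chart E j) := by
  ext c
  have h0 : (C c : MvPolynomial (Fin (n + 1)) k) ∈ homogeneousSubmodule (Fin (n + 1)) k (0 • 1) :=
    isHomogeneous_C _ _
  have h1 : HomogeneousLocalization.fromZeroRingHom (homogeneousSubmodule (Fin (n + 1)) k)
      (Submonoid.powers (X j)) (algebraMap k (homogeneousSubmodule (Fin (n + 1)) k 0) c) =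
      HomogeneousLocalization.Away.mk _ (X_mem j) 0 (C c) h0 := by
    apply HomogeneousLocalization.val_injective
    rw [HomogeneousLocalization.Away.val_mk]
    refine congrArg (Localization.mk (C c)) (Subtype.ext ?_)
    exact (pow_zero _).symm
  rw [RingHom.comp_apply, RingHom.comp_apply, h1, awayToChart_mk]
  exact (toChart E j).commutes c

theorem SpecMap_awayToChart_comp_projToSpec :
    Spec.map (CommRingCat.ofHom (awayToChart E j)) ≫
      Proj.awayι (homogeneousSubmodule (Fin (n + 1)) k) (X j) (X_mem j) one_pos ≫ projToSpec k n =
      Spec.map (CommRingCat.ofHom (algebraMap k (Chart E j))) := by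
  rw [projToSpec, Proj.awayι_toSpecZero_assoc, ← Spec.map_comp, ← Spec.map_comp,
    ← CommRingCat.ofHom_comp, ← CommRingCat.ofHom_comp, ← RingHom.comp_assoc,
    awayToChart_comp_algebraMap]

/-- The immersion of the chart `xⱼ = 1` of `V(E)` in projective space. -/
def chartMap (E : Set (MvPolynomial (Fin (n + 1)) k)) (j : Fin (n + 1)) :
    specVariety k (Chart E j) ⟶ projectiveSpace k n :=
  Variety.homMk (Spec.map (CommRingCat.ofHom (awayToChart E j)) ≫
    Proj.awayι (homogeneousSubmodule (Fin (n + 1)) k) (X j) (X_mem j) one_pos)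
    ((Category.assoc _ _ _).trans SpecMap_awayToChart_comp_projToSpec)

theorem isPreimmersion_chartMap : IsPreimmersion (chartMap E j).hom.left := by
  have h₁ := (IsClosedImmersion.iff_isPreimmersion.mp (IsClosedImmersion.spec_of_surjective
    (CommRingCat.ofHom (awayToChart E j)) awayToChart_surjective)).1
  have h₂ : IsPreimmersion
    (Proj.awayι (homogeneousSubmodule (Fin (n + 1)) k) (X j) (X_mem j) one_pos) := inferInstance
  exact IsPreimmersion.instIsMultiplicativeScheme.comp_mem _ _ h₁ h₂

/-- A form `p` of degree `m` vanishes at a point of the chart `xⱼ ≠ 0` if and only if `p / xⱼ ^ m`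
does. -/
theorem mem_awayι_iff {p : MvPolynomial (Fin (n + 1)) k} {m : ℕ} (hm : 0 < m)
    (hp : p.IsHomogeneous m) (hp' : p ∈ homogeneousSubmodule (Fin (n + 1)) k (m • 1))
    (q : PrimeSpectrum
      (HomogeneousLocalization.Away (homogeneousSubmodule (Fin (n + 1)) k) (X j))) :
    p ∈ (Proj.awayι (homogeneousSubmodule (Fin (n + 1)) k) (X j) (X_mem j) one_pos
      q).asHomogeneousIdeal ↔
      HomogeneousLocalization.Away.mk _ (X_mem j) m p hp' ∈ q.asIdeal := by
  have h := SetLike.ext_iff.mp (Proj.awayι_preimage_basicOpen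
    (homogeneousSubmodule (Fin (n + 1)) k) (X_mem j) one_pos hp hm) q
  have h' : HomogeneousLocalization.Away.isLocalizationElem (X_mem j) hp =
      HomogeneousLocalization.Away.mk _ (X_mem j) m p hp' := by
    apply HomogeneousLocalization.val_injective
    rw [HomogeneousLocalization.Away.val_mk, HomogeneousLocalization.Away.val_mk, pow_one]
  rw [h'] at h
  exact not_iff_not.mp h

/-- The locally closed subset `V(E) ∖ V(s)` of projective space. -/
def projCell (k : Type u) [Field k] {n : ℕ} (E : Set (MvPolynomial (Fin (n + 1)) k))
    (s : MvPolynomial (Fin (n + 1)) k) : Set (projectiveSpace k n).obj.left :=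
  {P : ProjectiveSpectrum (homogeneousSubmodule (Fin (n + 1)) k) |
    E ⊆ P.asHomogeneousIdeal ∧ s ∉ P.asHomogeneousIdeal}

theorem range_chartMap (hE : ∀ g ∈ E, ∃ d, 0 < d ∧ g.IsHomogeneous d) :
    Set.range (chartMap E j).hom.left = projCell k E (X j) := by
  have hmem {m : ℕ} {p : MvPolynomial (Fin (n + 1)) k} (hp : p.IsHomogeneous m) :
      p ∈ homogeneousSubmodule (Fin (n + 1)) k (m • 1) := by rwa [smul_eq_mul, mul_one]
  refine Set.Subset.antisymm ?_ ?_
  · rintro _ ⟨(Q : PrimeSpectrum (Chart E j)), rfl⟩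
    refine ⟨fun g hg => ?_, fun h => ?_⟩
    · obtain ⟨d, hd, hgd⟩ := hE g hg
      refine (mem_awayι_iff hd hgd (hmem hgd) _).mpr ?_
      change awayToChart E j _ ∈ Q.asIdeal
      rw [awayToChart_mk, toChart_eq_zero hg]
      exact zero_mem _
    · have h' := (mem_awayι_iff one_pos (isHomogeneous_X _ _) (hmem (isHomogeneous_X _ _)) _).mp h
      change awayToChart E j _ ∈ Q.asIdeal at h'
      rw [awayToChart_mk, toChart_X_self] at h'
      exact Q.isPrime.ne_top ((Ideal.eq_top_iff_one _).mpr h')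
  · rintro (P : ProjectiveSpectrum _) ⟨hP, hPj⟩
    have hr : P ∈ (Proj.awayι (homogeneousSubmodule (Fin (n + 1)) k) (X j) (X_mem j)
        one_pos).opensRange := by
      rw [Proj.opensRange_awayι]
      exact hPj
    obtain ⟨q, rfl⟩ := hr
    suffices hq : q ∈ Set.range (PrimeSpectrum.comap (awayToChart E j)) by
      obtain ⟨Q, rfl⟩ := hq
      exact ⟨Q, rfl⟩
    rw [range_comap_of_surjective _ _ awayToChart_surjective]
    intro a ha
    obtain ⟨m, p, hp, rfl⟩ := HomogeneousLocalization.Away.mk_surjective _ (X_mem j) a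
    have hp0 : toChart E j p = 0 := by
      rw [← awayToChart_mk m p hp]
      exact ha
    have hpm : p.IsHomogeneous m := by
      rw [smul_eq_mul, mul_one] at hp
      exact hp
    obtain ⟨N, hN⟩ := exists_X_pow_mul_mem (algebraMap_mem_of_toChart_eq_zero
      (fun g hg => (hE g hg).imp fun _ => And.right) hpm hp0)
    have hprime := (Proj.awayι (homogeneousSubmodule (Fin (n + 1)) k) (X j) (X_mem j) one_pos
      q).isPrime
    have hpP := (hprime.mem_or_mem (Ideal.span_le.mpr hP hN)).resolve_left
      fun h => hPj (hprime.mem_of_pow_mem _ h)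
    -- Multiplication by `xⱼ` makes the degree of the numerator positive.
    have hpX : (p * X j).IsHomogeneous (m + 1) := hpm.mul (isHomogeneous_X _ _)
    have hmk : HomogeneousLocalization.Away.mk _ (X_mem j) m p hp =
        HomogeneousLocalization.Away.mk _ (X_mem j) (m + 1) (p * X j) (hmem hpX) := by
      apply HomogeneousLocalization.val_injective
      rw [HomogeneousLocalization.Away.val_mk, HomogeneousLocalization.Away.val_mk,
        Localization.mk_eq_mk_iff, Localization.r_iff_exists]
      exact ⟨1, by change _ * (X j ^ (m + 1) * p) = _ * (X j ^ m * (p * X j)); ring⟩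
    rw [hmk]
    exact (mem_awayι_iff m.succ_pos hpX (hmem hpX) q).mp (Ideal.mul_mem_right _ _ hpP)

end Proj

/-! ### A projective hypersurface and its affine cone -/

section Strata

open MvPolynomial

variable {n : ℕ}

/-- `Spec k` is the unit of the tensor product. -/
theorem specCls_self (k : Type u) [Field k] : specCls k k = 1 := by
  have h : cls (𝟙_ (Variety k)) = 1 := rfl
  have hw : 𝟙 (Spec (CommRingCat.of k)) ≫ 𝟙 (Spec (CommRingCat.of k)) =
      Spec.map (CommRingCat.ofHom (algebraMap k k)) := by
    rw [Category.comp_id, ← Spec.map_id]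
    rfl
  let f : specVariety k k ⟶ 𝟙_ (Variety k) := Variety.homMk (𝟙 (Spec (CommRingCat.of k))) hw
  rw [← h]
  refine (cls_eq_of_surjective f ?_ ?_).symm
  · change IsPreimmersion (𝟙 (Spec (CommRingCat.of k)))
    infer_instance
  · exact (𝟙 (Spec (CommRingCat.of k)) : _ ⟶ _).surjective

theorem mem_idealOfVars_iff {σ R : Type*} [CommSemiring R] {p : MvPolynomial σ R} :
    p ∈ idealOfVars σ R ↔ coeff 0 p = 0 := by
  rw [← pow_one (idealOfVars σ R), mem_pow_idealOfVars_iff']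
  refine ⟨fun h => h 0 (by simp), fun h x hx => ?_⟩
  rwa [(Finsupp.degree_eq_zero_iff x).mp (Nat.lt_one_iff.mp hx)]

theorem mem_idealOfVars_of_isHomogeneous {σ R : Type*} [CommSemiring R] {p : MvPolynomial σ R}
    {d : ℕ} (hd : 0 < d) (hp : p.IsHomogeneous d) : p ∈ idealOfVars σ R :=
  mem_idealOfVars_iff.mpr (hp.coeff_eq_zero (by rw [map_zero]; exact hd.ne))

/-- The equations of the `j`-th stratum `x₀ = ⋯ = xⱼ₋₁ = 0` of the hypersurface `f = 0`. -/
def stratumEqs (f : MvPolynomial (Fin (n + 1)) k) (j : Fin (n + 1)) :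
    Set (MvPolynomial (Fin (n + 1)) k) := insert f (X '' {i | i < j})

theorem exists_isHomogeneous_of_mem_stratumEqs {f : MvPolynomial (Fin (n + 1)) k} {d : ℕ}
    (hd : 0 < d) (hf : f.IsHomogeneous d) {j : Fin (n + 1)} :
    ∀ g ∈ stratumEqs f j, ∃ d, 0 < d ∧ g.IsHomogeneous d := by
  rintro g (rfl | ⟨i, -, rfl⟩)
  · exact ⟨d, hd, hf⟩
  · exact ⟨1, one_pos, isHomogeneous_X _ _⟩

theorem stratumEqs_subset_iff {f : MvPolynomial (Fin (n + 1)) k} {j : Fin (n + 1)}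
    {I : Ideal (MvPolynomial (Fin (n + 1)) k)} :
    stratumEqs f j ⊆ I ↔ f ∈ I ∧ ∀ i < j, X i ∈ I := by
  rw [stratumEqs, Set.insert_subset_iff, Set.image_subset_iff]
  rfl

/-- The class of a hypersurface in projective space is the sum of the classes of its strata. -/
theorem IsClassOf.eq_sum_charts {f : MvPolynomial (Fin (n + 1)) k} {d : ℕ}
    (hd : 0 < d) (hf : f.IsHomogeneous d) {c : K0Var k}
    (hc : IsClassOf (projectiveSpace k n) (zeroSet f) c) :
    c = ∑ j : Fin (n + 1), specCls k (Chart (stratumEqs f j) j) := by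
  let 𝒜 := homogeneousSubmodule (Fin (n + 1)) k
  let T (i : Fin (n + 1)) : Set (projectiveSpace k n).obj.left :=
    {P : ProjectiveSpectrum 𝒜 | X i ∈ P.asHomogeneousIdeal.toIdeal}
  have hT (i : Fin (n + 1)) : IsClosed (T i) := by
    have h : T i = ProjectiveSpectrum.zeroLocus 𝒜 {X i} :=
      Set.ext fun P : ProjectiveSpectrum 𝒜 => by
        change (X i : MvPolynomial (Fin (n + 1)) k) ∈ P.asHomogeneousIdeal.toIdeal ↔
          ({X i} : Set (MvPolynomial (Fin (n + 1)) k)) ⊆ _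
        exact Set.singleton_subset_iff.symm
    rw [h]
    exact ProjectiveSpectrum.isClosed_zeroLocus 𝒜 {X i}
  have hf' (P : ProjectiveSpectrum 𝒜) : P ∈ ProjectiveSpectrum.zeroLocus 𝒜 {f} ↔
      f ∈ P.asHomogeneousIdeal.toIdeal := Set.singleton_subset_iff
  refine (hc.eq_sum_strata hT (b := 0) (fun j => ?_) ?_).trans (add_zero _)
  · refine ⟨_, chartMap _ _, isPreimmersion_chartMap, ?_, rfl⟩
    rw [range_chartMap (exists_isHomogeneous_of_mem_stratumEqs hd hf)]
    refine Set.ext fun P : ProjectiveSpectrum 𝒜 => ?_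
    exact and_congr_left fun _ => stratumEqs_subset_iff.trans (and_congr_left fun _ => (hf' P).symm)
  · have h : {x | x ∈ zeroSet f ∧ ∀ i, x ∈ T i} = ∅ := by
      rw [Set.eq_empty_iff_forall_notMem]
      rintro (P : ProjectiveSpectrum 𝒜) ⟨-, hP⟩
      have hle : idealOfVars (Fin (n + 1)) k ≤ P.asHomogeneousIdeal.toIdeal :=
        Ideal.span_le.mpr (Set.range_subset_iff.mpr hP)
      exact P.not_irrelevant_le ((HomogeneousIdeal.irrelevant_le 𝒜).mpr fun i hi p hp =>
        hle (mem_idealOfVars_of_isHomogeneous hi hp))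
    rw [h]
    exact isClassOf_empty _

/-- The class of the affine cone over a hypersurface is the sum of the classes of its strata and
of the class of the vertex. -/
theorem specCls_cone_eq_sum {f : MvPolynomial (Fin (n + 1)) k} {d : ℕ}
    (hd : 0 < d) (hf : f.IsHomogeneous d) :
    specCls k (MvPolynomial (Fin (n + 1)) k ⧸ Ideal.span {f}) =
      ∑ j : Fin (n + 1), specCls k (Localization.Away
        (Polynomial.X : Polynomial (Chart (stratumEqs f j) j))) + 1 := by
  let T (i : Fin (n + 1)) : Set (specVariety k (MvPolynomial (Fin (n + 1)) k)).obj.left :=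
    {P : PrimeSpectrum (MvPolynomial (Fin (n + 1)) k) | X i ∈ P.asIdeal}
  have hT (i : Fin (n + 1)) : IsClosed (T i) := by
    have h : T i = PrimeSpectrum.zeroLocus {X i} :=
      Set.ext fun P : PrimeSpectrum (MvPolynomial (Fin (n + 1)) k) => by
        change (X i : MvPolynomial (Fin (n + 1)) k) ∈ P.asIdeal ↔
          ({X i} : Set (MvPolynomial (Fin (n + 1)) k)) ⊆ _
        exact Set.singleton_subset_iff.symm
    rw [h]
    exact isClosed_specZeroLocus (k := k) {X (R := k) i}
  have h1 (P : PrimeSpectrum (MvPolynomial (Fin (n + 1)) k)) : 1 ∉ P.asIdeal :=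
    fun h => P.isPrime.ne_top ((Ideal.eq_top_iff_one _).mpr h)
  have hf' (P : PrimeSpectrum (MvPolynomial (Fin (n + 1)) k)) : P ∈ specCell k {f} 1 ↔
      f ∈ P.asIdeal := by
    refine Iff.trans (and_iff_left (h1 P)) Set.singleton_subset_iff
  refine (isClassOf_quotient (k := k) (Ideal.span {f}) rfl).eq_sum_strata hT (fun j => ?_) ?_
  · convert isClassOf_cone (k := k) (j := j) (E := stratumEqs f j) fun g hg =>
      (exists_isHomogeneous_of_mem_stratumEqs hd hf g hg).imp fun _ => And.right using 1
    refine Set.ext fun P : PrimeSpectrum _ => ?_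
    exact (and_congr_left fun _ => stratumEqs_subset_iff.trans
      (and_congr_left fun _ => (hf' P).symm)).symm
  · rw [← specCls_self k]
    convert isClassOf_of_surjective (k := k) (E := Set.range X)
      (aeval 0 : MvPolynomial (Fin (n + 1)) k →ₐ[k] k) (fun c => ⟨C c, by simp⟩) ?_ using 1
    · refine Set.ext fun P : PrimeSpectrum _ => ?_
      refine Iff.trans ?_ (and_iff_left (h1 P)).symm
      refine Iff.trans ?_ Set.range_subset_iff.symm
      refine and_iff_right_of_imp fun h => (hf' P).mpr ?_
      have hle : idealOfVars (Fin (n + 1)) k ≤ P.asIdeal :=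
        Ideal.span_le.mpr (Set.range_subset_iff.mpr h)
      exact hle (mem_idealOfVars_of_isHomogeneous hd hf)
    · ext p
      rw [RingHom.mem_ker, ← idealOfVars, mem_idealOfVars_iff]
      change aeval 0 p = 0 ↔ _
      rw [← constantCoeff_eq, aeval_zero]
      rfl

/-- The projective hypersurface and its affine cone: modulo `𝕃`, the punctured cone has the class
of `𝔾ₘ × X`, that is `-[X]`. -/
theorem IsClassOf.mk_eq_one_sub {f : MvPolynomial (Fin (n + 1)) k} {d : ℕ}
    (hd : 0 < d) (hf : f.IsHomogeneous d) {c : K0Var k}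
    (hc : IsClassOf (projectiveSpace k n) (zeroSet f) c) :
    Ideal.Quotient.mk (Ideal.span {lefschetz k}) c =
      1 - specClsModL k (MvPolynomial (Fin (n + 1)) k ⧸ Ideal.span {f}) := by
  have h (j : Fin (n + 1)) : Ideal.Quotient.mk (Ideal.span {lefschetz k}) (specCls k
      (Localization.Away (Polynomial.X : Polynomial (Chart (stratumEqs f j) j)))) =
      -Ideal.Quotient.mk _ (specCls k (Chart (stratumEqs f j) j)) :=
    specClsModL_punctured _
  rw [hc.eq_sum_charts hd hf, specClsModL, specCls_cone_eq_sum hd hf, map_add, map_one, map_sum,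
    map_sum, Finset.sum_congr rfl fun j _ => h j, Finset.sum_neg_distrib]
  ring

end Strata

end GrothendieckRing

end

theorem theorem6p1 {k : Type u} [Field k] (hk : GrothendieckRing.IsC1Field k)
    {n : ℕ} (hn : 3 ≤ n)
    (f : MvPolynomial (Fin (n + 1)) k) (hf0 : f ≠ 0) (hf : f.IsHomogeneous 3)
    (X : GrothendieckRing.Variety k) (i : X ⟶ GrothendieckRing.projectiveSpace k n)
    (hX : GrothendieckRing.IsHypersurface f i)
    (hsing : (GrothendieckRing.singularPoints f).Nonempty) :
    GrothendieckRing.cls X ≡ 1 [SMOD Ideal.span {GrothendieckRing.lefschetz k}] := by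
  obtain ⟨x, hx, hx'⟩ := hsing
  obtain ⟨m, rfl⟩ := Nat.exists_eq_add_of_le' hn
  have := hX.isClosedImmersion
  have hc := GrothendieckRing.isClassOf_range i inferInstance
  rw [hX.range_eq] at hc
  have h := hc.mk_eq_one_sub three_pos hf
  rw [GrothendieckRing.specClsModL_cubic hk hf x.rep_nonzero hx hx', sub_zero] at h
  exact h
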